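/- Let $\lambda$ be a partition (identified with its Young diagram) and let $x=(x_1,x_2,\dots)$ be infinitely many commuting variables. A horizontal strip is a skew diagram with at most one box in each column. A semistandard oscillating tableau (SSOT) of shape $\lambda$ is a sequence of partitions $S=(S^1,S'^2,S^2,S'^3,S^3,\dots)$ such that, with $S^0=S'^1=\emptyset$, for every $i\ge1$ one has $S'^i\subseteq S^{i-1}$ and $S'^i\subseteq S^i$, the skew diagrams $S^{i-1}/S'^i$ and $S^i/S'^i$ are (possibly empty) horizontal strips, and for some $k\ge0$ one has $S^k=S'^{k+1}=S^{k+1}=\cdots=\lambda$. Put $m_i(S)=|S^{i-1}/S'^i|+|S^i/S'^i|$; the length of $S$ is $n=\sum_{i\ge1}m_i(S)$ and its weight monomial is $x^S=\prod_{i\ge1}x_i^{m_i(S)}$. Let $\mathrm{SSOT}_n(\lambda)$ be the set of SSOTs of shape $\lambda$ and length $n$, and define $$\mathrm{ss}_{\lambda,n}(x)=\sum_{S\in\mathrm{SSOT}_n(\lambda)}x^S,\qquad \mathrm{ss}_\lambda(x)=\sum_{n\ge0}\mathrm{ss}_{\lambda,n}(x).$$ Let $s_\lambda(x)$ be the Schur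 function, the sum of the weight monomials of all semistandard Young tableaux of shape $\lambda$ with positive integer entries. Theorem. In the ring of formal power series in $x_1,x_2,\dots$ over $\mathbb Z$, all the infinite sums above and the infinite product below are well defined (they converge coefficientwise), and $$\mathrm{ss}_\lambda(x)=\prod_{i<j}(1-x_ix_j)^{-1}\,s_\lambda(x).$$ Corollary. $\mathrm{ss}_\lambda(x)$ is symmetric, i.e. invariant under all permutations of the variables. -/

import Mathlib

open scoped MvPowerSeries.WithPiTopology

/-- `ν ⊆ μ` and the skew diagram `μ / ν` has at most one box in each column.
Boxes are pairs `(row, column)`. -/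
def IsHorizontalStrip (ν μ : YoungDiagram) : Prop :=
  ν ≤ μ ∧ ∀ b ∈ μ.cells \ ν.cells, ∀ c ∈ μ.cells \ ν.cells, b.2 = c.2 → b = c

/-- Semistandard oscillating tableaux of shape `μ` and length `n`.
In the sequence `(S^1, S'^2, S^2, S'^3, S^3, …)` the diagram `S^i` is `full i` and the diagram
`S'^(i+1)` is `part i`, with the convention `S^0 = S'^1 = ∅`.  Thus the step with number `i + 1`
removes the horizontal strip `full i / part i` and then adds the horizontal strip
`full (i + 1) / part i`. -/
@[ext]
structure SSOT (n : ℕ) (μ : YoungDiagram) where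
  full : ℕ → YoungDiagram
  part : ℕ → YoungDiagram
  full_zero : full 0 = ⊥
  strip_removed : ∀ i, IsHorizontalStrip (part i) (full i)
  strip_added : ∀ i, IsHorizontalStrip (part i) (full (i + 1))
  exists_steps : ∃ k : ℕ, (∀ i, k ≤ i → full i = μ ∧ part i = μ) ∧
    n = ∑ i ∈ Finset.range k,
      (((full i).cells \ (part i).cells).card + ((full (i + 1)).cells \ (part i).cells).card)

namespace SSOT

variable {n : ℕ} {μ : YoungDiagram}

/-- The number of boxes removed or added in the step with number `i + 1`: the multiplicity
of the letter `i + 1` in the content of `S`. -/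
def stepSize (S : SSOT n μ) (i : ℕ) : ℕ :=
  ((S.full i).cells \ (S.part i).cells).card + ((S.full (i + 1)).cells \ (S.part i).cells).card

theorem finite_support_stepSize (S : SSOT n μ) : (Function.support S.stepSize).Finite := by
  obtain ⟨k, hk, -⟩ := S.exists_steps
  refine (Set.finite_lt_nat k).subset fun i hi => ?_
  by_contra h
  have h' : k ≤ i := not_lt.mp h
  apply hi
  simp [stepSize, (hk i h').1, (hk i h').2, (hk (i + 1) (by omega)).1]

/-- The exponent vector of the weight monomial of `S`. -/
noncomputable def weight (S : SSOT n μ) : ℕ →₀ ℕ :=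
  Finsupp.ofSupportFinite S.stepSize S.finite_support_stepSize

/-- The weight monomial of `S`. The variable `X i` stands for `x_{i+1}`. -/
noncomputable def weightMonomial (S : SSOT n μ) : MvPowerSeries ℕ ℤ :=
  MvPowerSeries.monomial S.weight 1

end SSOT

/-- The SSOT function of degree `n`. It is zero if `n < |μ|` or `n - |μ|` is odd, as there is then
no such tableau. -/
noncomputable def ssotFunctionOfDegree (μ : YoungDiagram) (n : ℕ) : MvPowerSeries ℕ ℤ :=
  ∑' S : SSOT n μ, S.weightMonomial

/-- The full SSOT function. -/
noncomputable def ssotFunction (μ : YoungDiagram) : MvPowerSeries ℕ ℤ :=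
  ∑' n : ℕ, ssotFunctionOfDegree μ n

/-- The weight monomial of a semistandard Young tableau with entries `0, 1, 2, …`;
an entry `i` contributes the variable `X i`. -/
noncomputable def SemistandardYoungTableau.weightMonomial {μ : YoungDiagram}
    (T : SemistandardYoungTableau μ) : MvPowerSeries ℕ ℤ :=
  ∏ b ∈ μ.cells, MvPowerSeries.X (T b.1 b.2)

/-- The Schur function in infinitely many variables. -/
noncomputable def schurFunction (μ : YoungDiagram) : MvPowerSeries ℕ ℤ :=
  ∑' T : SemistandardYoungTableau μ, T.weightMonomial

/-- The power series `(1 - x_i x_j)⁻¹`. -/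
noncomputable def littlewoodFactor (i j : ℕ) : MvPowerSeries ℕ ℤ :=
  MvPowerSeries.invOfUnit (1 - MvPowerSeries.X i * MvPowerSeries.X j) 1

/-- Invariance of a power series under all permutations of the variables. -/
def IsSymmetricSeries (f : MvPowerSeries ℕ ℤ) : Prop :=
  ∀ σ : Equiv.Perm ℕ, MvPowerSeries.renameEquiv ℤ σ f = f

/-! Adding a horizontal strip with letter `a` and removing one with letter `b` commute up to the
factor `(1 - x_a x_b)⁻¹`. This rests on a bijection (`localRule`): in terms of row lengths, a
diagram γ above both α and β satisfies max(α_{i+1}, β_{i+1}) ≤ γ_{i+1} ≤ min(α_i, β_i), and a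
diagram δ below both has its row δ_i in this same interval. Reflecting the interval turns γ_{i+1}
into δ_i. Only γ_0 is left over; its excess k over max(α_0, β_0) is a free natural number, and
summing (x_a x_b)^k over k gives the factor.

The branching rule builds a Schur polynomial by adding one strip per variable. Moving the removal of
a strip with letter `m` past all these additions, down to the empty diagram, gives the product of
the (1 - x_i x_m)⁻¹ (`hasSum_stripWeight_mul_schurList`). In an oscillating sequence with N + 1
steps, the last step removes a strip and then adds one, both with the last variable x. Summing over
the removal produces the factors (1 - x_i x)⁻¹ for all earlier x_i; summing over the addition is the
branching rule. Induction on N proves the formula in finitely many variables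
(`hasSum_isOscillating`).

Every coefficient involves finitely many variables, so the formula passes to the limit. Symmetry of
the product is a reindexing of pairs; symmetry of the Schur function comes from the Bender--Knuth
reflection (`swapDiagram`), which exchanges two adjacent letters. -/

namespace YoungDiagram

/-! ### Young diagrams through their row lengths -/

theorem le_iff_rowLen_le {ν μ : YoungDiagram} : ν ≤ μ ↔ ∀ i, ν.rowLen i ≤ μ.rowLen i := by
  constructor
  · intro h i
    by_contra! hi
    have : (i, μ.rowLen i) ∈ ν := mem_iff_lt_rowLen.2 hi
    exact absurd (mem_iff_lt_rowLen.1 (h this)) (lt_irrefl _)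
  · rintro h ⟨i, j⟩ hb
    exact mem_iff_lt_rowLen.2 ((mem_iff_lt_rowLen.1 hb).trans_le (h i))

theorem ext_rowLen {ν μ : YoungDiagram} (h : ∀ i, ν.rowLen i = μ.rowLen i) : ν = μ :=
  le_antisymm (le_iff_rowLen_le.2 fun i => (h i).le) (le_iff_rowLen_le.2 fun i => (h i).ge)

/-- If μ_{i+1} > ν_i, then the boxes of column ν_i in rows i and i + 1 both lie in the skew diagram.
Conversely, under interlacing no box of μ lies below a box outside ν. Strips thus become linear
inequalities between row lengths, which `omega` can handle. -/
theorem isHorizontalStrip_iff {ν μ : YoungDiagram} :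
    IsHorizontalStrip ν μ ↔ ∀ i, ν.rowLen i ≤ μ.rowLen i ∧ μ.rowLen (i + 1) ≤ ν.rowLen i := by
  constructor
  · rintro ⟨hle, h⟩ i
    refine ⟨le_iff_rowLen_le.1 hle i, ?_⟩
    by_contra! hi
    have h1 : (i + 1, ν.rowLen i) ∈ μ := mem_iff_lt_rowLen.2 hi
    have h2 : (i, ν.rowLen i) ∈ μ := μ.up_left_mem (Nat.le_succ i) le_rfl h1
    have h3 : (i, ν.rowLen i) ∉ ν := fun hc => lt_irrefl _ (mem_iff_lt_rowLen.1 hc)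
    have h4 : (i + 1, ν.rowLen i) ∉ ν := fun hc => h3 (ν.up_left_mem (Nat.le_succ i) le_rfl hc)
    have := h (i, ν.rowLen i) (by simp [h2, h3]) (i + 1, ν.rowLen i) (by simp [h1, h4]) rfl
    simp at this
  · intro h
    have key : ∀ i i' j, (i', j) ∈ μ → (i, j) ∉ ν → ¬ i < i' := by
      intro i i' j h1 h2 hlt
      rw [mem_iff_lt_rowLen] at h1 h2
      have := μ.rowLen_anti (i + 1) i' hlt
      have := (h i).2
      omega
    refine ⟨le_iff_rowLen_le.2 fun i => (h i).1, ?_⟩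
    rintro ⟨i, j⟩ hb ⟨i', j'⟩ hc hj
    simp only [Finset.mem_sdiff, mem_cells] at hb hc hj
    subst hj
    have := key i i' j hc.1 hb.2
    have := key i' i j hb.1 hc.2
    rw [show i = i' by omega]

/-- The Young diagram with prescribed row lengths. -/
def ofRowLen (f : ℕ → ℕ) (hf : Antitone f) (M : ℕ) (_hM : f M = 0) : YoungDiagram where
  cells := (Finset.range M ×ˢ Finset.range (f 0)).filter fun c => c.2 < f c.1
  isLowerSet := by
    rintro ⟨i, j⟩ ⟨i', j'⟩ ⟨hi, hj⟩ hb
    simp only [Finset.coe_filter, Finset.mem_product, Finset.mem_range, Set.mem_ofPred_eq] at hb ⊢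
    simp only at hi hj
    have := hf hi
    omega

theorem rowLen_ofRowLen (f : ℕ → ℕ) (hf : Antitone f) (M : ℕ) (hM : f M = 0) (i : ℕ) :
    (ofRowLen f hf M hM).rowLen i = f i := by
  have key : ∀ j, j < (ofRowLen f hf M hM).rowLen i ↔ j < f i := by
    intro j
    rw [← mem_iff_lt_rowLen, ← mem_cells]
    simp only [ofRowLen, Finset.mem_filter, Finset.mem_product, Finset.mem_range]
    refine ⟨fun h => h.2, fun h => ⟨⟨?_, h.trans_le (hf (Nat.zero_le i))⟩, h⟩⟩
    by_contra! hi
    have := hf hi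
    omega
  have h1 := key (f i)
  have h2 := key ((ofRowLen f hf M hM).rowLen i)
  omega

theorem rowLen_eq_zero_of_le {μ : YoungDiagram} {M N : ℕ} (h : M ≤ N) (hM : μ.rowLen M = 0) :
    μ.rowLen N = 0 := by
  have := μ.rowLen_anti M N h
  omega

theorem exists_rowLen_eq_zero (μ : YoungDiagram) : ∃ M, μ.rowLen M = 0 := by
  refine ⟨μ.colLen 0, ?_⟩
  by_contra h
  have : (μ.colLen 0, 0) ∈ μ := mem_iff_lt_rowLen.2 (Nat.pos_of_ne_zero h)
  exact absurd (mem_iff_lt_colLen.1 this) (lt_irrefl _)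

theorem card_eq_sum_rowLen {μ : YoungDiagram} {M : ℕ} (hM : μ.rowLen M = 0) :
    μ.card = ∑ i ∈ Finset.range M, μ.rowLen i := by
  rw [YoungDiagram.card, Finset.card_eq_sum_card_fiberwise (f := Prod.fst) (t := Finset.range M)]
  · simp_rw [rowLen_eq_card]
    rfl
  · rintro ⟨i, j⟩ hb
    simp only [Finset.coe_range, Set.mem_Iio]
    by_contra! hi
    have h1 : j < μ.rowLen i := mem_iff_lt_rowLen.1 hb
    have := rowLen_eq_zero_of_le hi hM
    omega

theorem card_le_card {ν μ : YoungDiagram} (h : ν ≤ μ) : ν.card ≤ μ.card :=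
  Finset.card_le_card (cells_subset_iff.2 h)

theorem eq_of_le_of_card_eq {ν μ : YoungDiagram} (h : ν ≤ μ) (hc : ν.card = μ.card) : ν = μ :=
  YoungDiagram.ext (Finset.eq_of_subset_of_card_le (cells_subset_iff.2 h) hc.ge)

theorem card_sdiff_cells {ν μ : YoungDiagram} (h : ν ≤ μ) :
    (μ.cells \ ν.cells).card = μ.card - ν.card :=
  Finset.card_sdiff_of_subset (cells_subset_iff.2 h)

/-- A box (i, j) forces the i + 1 boxes of its column up to it and the j + 1 boxes of its row up to
it, so the diagram fits into an n × n square. -/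
theorem finite_setOf_card_le (n : ℕ) : {μ : YoungDiagram | μ.card ≤ n}.Finite := by
  refine Set.Finite.of_finite_image (f := YoungDiagram.cells)
    ((((Finset.range n ×ˢ Finset.range n).powerset).finite_toSet).subset ?_)
    (fun a _ b _ h => YoungDiagram.ext h)
  rintro _ ⟨μ, hμ, rfl⟩
  simp only [Finset.coe_powerset, Set.mem_preimage, Set.mem_powerset_iff, Finset.coe_subset]
  rintro ⟨i, j⟩ hb
  have hb' : (i, j) ∈ μ := hb
  have h1 : (Finset.range (i + 1) ×ˢ {j}).card ≤ μ.card := Finset.card_le_card fun ⟨i', j'⟩ h => by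
    simp only [Finset.mem_product, Finset.mem_range, Finset.mem_singleton] at h
    exact μ.up_left_mem (by omega) (by omega) hb'
  have h2 : ({i} ×ˢ Finset.range (j + 1)).card ≤ μ.card := Finset.card_le_card fun ⟨i', j'⟩ h => by
    simp only [Finset.mem_product, Finset.mem_range, Finset.mem_singleton] at h
    exact μ.up_left_mem (by omega) (by omega) hb'
  simp only [Finset.card_product, Finset.card_range, Finset.card_singleton] at h1 h2
  simp only [Set.mem_ofPred_eq] at hμ
  simp only [Finset.mem_product, Finset.mem_range]
  omega

/-- The finite set of Young diagrams contained in a given one. -/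
noncomputable def below (μ : YoungDiagram) : Finset YoungDiagram :=
  ((finite_setOf_card_le μ.card).subset fun _ h => card_le_card h : {ν | ν ≤ μ}.Finite).toFinset

@[simp]
theorem mem_below {ν μ : YoungDiagram} : ν ∈ below μ ↔ ν ≤ μ := by
  simp [below]

end YoungDiagram

open YoungDiagram

namespace IsHorizontalStrip

theorem le {ν μ : YoungDiagram} (h : IsHorizontalStrip ν μ) : ν ≤ μ := h.1

theorem refl (μ : YoungDiagram) : IsHorizontalStrip μ μ := by
  simp [IsHorizontalStrip]

theorem lower {ν μ : YoungDiagram} (h : IsHorizontalStrip ν μ) (i : ℕ) :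
    ν.rowLen i ≤ μ.rowLen i := (isHorizontalStrip_iff.1 h i).1

theorem upper {ν μ : YoungDiagram} (h : IsHorizontalStrip ν μ) (i : ℕ) :
    μ.rowLen (i + 1) ≤ ν.rowLen i := (isHorizontalStrip_iff.1 h i).2

end IsHorizontalStrip

/-! ### Local rules: reflecting row lengths in intervals -/

section LocalRules

variable (α β : YoungDiagram)

/-- Row lengths of the common upper diagram obtained by reflecting a common lower diagram `δ`. -/
def upperRow (k : ℕ) (δ : YoungDiagram) : ℕ → ℕ
  | 0 => max (α.rowLen 0) (β.rowLen 0) + k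
  | i + 1 => max (α.rowLen (i + 1)) (β.rowLen (i + 1)) + min (α.rowLen i) (β.rowLen i) - δ.rowLen i

/-- Row lengths of the common lower diagram obtained by reflecting a common upper diagram `γ`. -/
def lowerRow (γ : YoungDiagram) (i : ℕ) : ℕ :=
  max (α.rowLen (i + 1)) (β.rowLen (i + 1)) + min (α.rowLen i) (β.rowLen i) - γ.rowLen (i + 1)

/-- Row i of the result lies in the interval from max(α_{i+1}, β_{i+1}) to min(α_i, β_i), because
γ_{i+1} does and the interval is reflected onto itself. The intervals for successive i lie one below
the other. In particular the natural subtraction is never truncated. -/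
theorem antitone_lowerRow {γ : YoungDiagram} (hα : IsHorizontalStrip α γ)
    (hβ : IsHorizontalStrip β γ) : Antitone (lowerRow α β γ) := by
  refine antitone_nat_of_succ_le fun i => ?_
  have := hα.lower (i + 1)
  have := hβ.lower (i + 1)
  have := hα.upper i
  have := hβ.upper i
  have := hα.lower (i + 2)
  have := hβ.lower (i + 2)
  have := hα.upper (i + 1)
  have := hβ.upper (i + 1)
  simp only [lowerRow, Nat.add_assoc, Nat.reduceAdd] at *
  omega

theorem antitone_upperRow (k : ℕ) {δ : YoungDiagram} (hα : IsHorizontalStrip δ α)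
    (hβ : IsHorizontalStrip δ β) : Antitone (upperRow α β k δ) := by
  refine antitone_nat_of_succ_le fun i => ?_
  cases i with
  | zero =>
    have := hα.upper 0
    have := hβ.upper 0
    have := hα.lower 0
    have := hβ.lower 0
    simp only [upperRow]
    omega
  | succ i =>
    have := hα.lower (i + 1)
    have := hβ.lower (i + 1)
    have := hα.upper i
    have := hβ.upper i
    have := hα.lower i
    have := hβ.lower i
    have := hα.upper (i + 1)
    have := hβ.upper (i + 1)
    simp only [upperRow]
    omega

theorem exists_lowerRow_eq_zero (γ : YoungDiagram) : ∃ M, lowerRow α β γ M = 0 := by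
  obtain ⟨A, hA⟩ := α.exists_rowLen_eq_zero
  obtain ⟨B, hB⟩ := β.exists_rowLen_eq_zero
  refine ⟨max A B, ?_⟩
  have h1 := rowLen_eq_zero_of_le (le_max_left A B) hA
  have h2 := rowLen_eq_zero_of_le (le_max_right A B) hB
  have h3 := rowLen_eq_zero_of_le (Nat.le_succ _) h1
  have h4 := rowLen_eq_zero_of_le (Nat.le_succ _) h2
  simp only [lowerRow, Nat.succ_eq_add_one] at *
  omega

theorem exists_upperRow_eq_zero (k : ℕ) (δ : YoungDiagram) : ∃ M, upperRow α β k δ M = 0 := by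
  obtain ⟨M, hM⟩ := exists_lowerRow_eq_zero α β ⊥
  refine ⟨M + 1, ?_⟩
  have h0 : (⊥ : YoungDiagram).rowLen (M + 1) = 0 := by
    by_contra h
    exact YoungDiagram.notMem_bot _ (mem_iff_lt_rowLen.2 (Nat.pos_of_ne_zero h))
  simp only [upperRow, lowerRow] at *
  omega

/-- The common lower diagram corresponding to a common upper diagram. -/
noncomputable def lowerDiagram {γ : YoungDiagram} (hα : IsHorizontalStrip α γ)
    (hβ : IsHorizontalStrip β γ) : YoungDiagram :=
  ofRowLen _ (antitone_lowerRow α β hα hβ) _ (exists_lowerRow_eq_zero α β γ).choose_spec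

/-- The common upper diagram corresponding to a number and a common lower diagram. -/
noncomputable def upperDiagram (k : ℕ) {δ : YoungDiagram} (hα : IsHorizontalStrip δ α)
    (hβ : IsHorizontalStrip δ β) : YoungDiagram :=
  ofRowLen _ (antitone_upperRow α β k hα hβ) _ (exists_upperRow_eq_zero α β k δ).choose_spec

theorem rowLen_lowerDiagram {γ : YoungDiagram} (hα : IsHorizontalStrip α γ)
    (hβ : IsHorizontalStrip β γ) (i : ℕ) :
    (lowerDiagram α β hα hβ).rowLen i = lowerRow α β γ i := rowLen_ofRowLen ..

theorem rowLen_upperDiagram (k : ℕ) {δ : YoungDiagram} (hα : IsHorizontalStrip δ α)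
    (hβ : IsHorizontalStrip δ β) (i : ℕ) :
    (upperDiagram α β k hα hβ).rowLen i = upperRow α β k δ i := rowLen_ofRowLen ..

/-- The local rule: common upper diagrams of `α` and `β` correspond to common lower diagrams
together with a natural number. -/
noncomputable def localRule :
    {γ : YoungDiagram // IsHorizontalStrip α γ ∧ IsHorizontalStrip β γ} ≃
      ℕ × {δ : YoungDiagram // IsHorizontalStrip δ α ∧ IsHorizontalStrip δ β} where
  -- The first row of γ has no upper bound, so it cannot be reflected; its excess is recorded as the
  -- number.
  toFun γ := (γ.1.rowLen 0 - max (α.rowLen 0) (β.rowLen 0), ⟨lowerDiagram α β γ.2.1 γ.2.2, by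
    obtain ⟨γ, hα, hβ⟩ := γ
    constructor
    all_goals
      refine isHorizontalStrip_iff.2 fun i => ?_
      rw [rowLen_lowerDiagram]
      have := hα.lower (i + 1)
      have := hβ.lower (i + 1)
      have := hα.upper i
      have := hβ.upper i
      simp only [lowerRow]
      omega⟩)
  invFun p := ⟨upperDiagram α β p.1 p.2.2.1 p.2.2.2, by
    obtain ⟨k, δ, hα, hβ⟩ := p
    constructor
    all_goals
      refine isHorizontalStrip_iff.2 fun i => ?_
      rw [rowLen_upperDiagram, rowLen_upperDiagram]
      have := hα.lower i
      have := hβ.lower i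
      have := hα.upper i
      have := hβ.upper i
      cases i with
      | zero =>
        simp only [upperRow]
        omega
      | succ i =>
        have := hα.lower i
        have := hβ.lower i
        have := hα.upper i
        have := hβ.upper i
        simp only [upperRow]
        omega⟩
  left_inv := by
    rintro ⟨γ, hα, hβ⟩
    refine Subtype.ext (ext_rowLen fun i => ?_)
    simp only [rowLen_upperDiagram]
    cases i with
    | zero =>
      have := hα.lower 0
      have := hβ.lower 0
      simp only [upperRow]
      omega
    | succ i =>
      have := hα.lower (i + 1)
      have := hβ.lower (i + 1)
      have := hα.upper i
      have := hβ.upper i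
      simp only [upperRow, rowLen_lowerDiagram, lowerRow]
      omega
  right_inv := by
    rintro ⟨k, δ, hα, hβ⟩
    refine Prod.ext ?_ (Subtype.ext (ext_rowLen fun i => ?_))
    · simp only [rowLen_upperDiagram, upperRow]
      omega
    · have := hα.lower i
      have := hβ.lower i
      have := hα.upper i
      have := hβ.upper i
      simp only [rowLen_lowerDiagram, lowerRow, rowLen_upperDiagram, upperRow]
      omega

theorem card_upperDiagram (k : ℕ) {δ : YoungDiagram} (hα : IsHorizontalStrip δ α)
    (hβ : IsHorizontalStrip δ β) :
    (upperDiagram α β k hα hβ).card + δ.card = α.card + β.card + k := by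
  obtain ⟨A, hA⟩ := α.exists_rowLen_eq_zero
  obtain ⟨B, hB⟩ := β.exists_rowLen_eq_zero
  have hα0 := rowLen_eq_zero_of_le (le_max_left A B) hA
  have hβ0 := rowLen_eq_zero_of_le (le_max_right A B) hB
  generalize max A B = M at hα0 hβ0
  have hα1 := rowLen_eq_zero_of_le (Nat.le_succ _) hα0
  have hβ1 := rowLen_eq_zero_of_le (Nat.le_succ _) hβ0
  have hδ0 : δ.rowLen M = 0 := by
    have := hα.lower M
    omega
  have hγ : (upperDiagram α β k hα hβ).rowLen (M + 1) = 0 := by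
    simp only [rowLen_upperDiagram, upperRow, Nat.succ_eq_add_one] at *
    omega
  rw [card_eq_sum_rowLen hγ, card_eq_sum_rowLen hδ0, Finset.sum_range_succ',
    card_eq_sum_rowLen hα1, card_eq_sum_rowLen hβ1, Nat.succ_eq_add_one]
  -- Max and min of α_i and β_i add up to α_i + β_i, but the min enters one row later than the max.
  -- The truncated sum therefore lacks min(α_m, β_m), which vanishes at m = M.
  have key : ∀ m, (∑ i ∈ Finset.range m, (upperDiagram α β k hα hβ).rowLen (i + 1)) +
      (upperDiagram α β k hα hβ).rowLen 0 + ∑ i ∈ Finset.range m, δ.rowLen i + 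
        min (α.rowLen m) (β.rowLen m) =
      ∑ i ∈ Finset.range (m + 1), α.rowLen i + ∑ i ∈ Finset.range (m + 1), β.rowLen i + k := by
    intro m
    induction m with
    | zero =>
      simp [rowLen_upperDiagram, upperRow]
      omega
    | succ m ih =>
      rw [Finset.sum_range_succ, Finset.sum_range_succ _ m, Finset.sum_range_succ _ (m + 1),
        Finset.sum_range_succ _ (m + 1), rowLen_upperDiagram _ _ _ _ _ (m + 1)]
      have := hα.lower m
      have := hβ.lower m
      simp only [upperRow]
      omega
  have := key M
  omega

/-- Row lengths of the Bender--Knuth reflection of `ν` between `α` and `β`. -/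
def swapRow (ν : YoungDiagram) : ℕ → ℕ
  | 0 => max (α.rowLen 0) (β.rowLen 1) + β.rowLen 0 - ν.rowLen 0
  | i + 1 => max (α.rowLen (i + 1)) (β.rowLen (i + 2)) + min (β.rowLen (i + 1)) (α.rowLen i) -
      ν.rowLen (i + 1)

variable {α β} {ν : YoungDiagram}

/-- The two interlacing conditions confine ν_i exactly to the interval from max(α_i, β_{i+1}) to
min(β_i, α_{i-1}), with upper end β_0 for i = 0. The reflection preserves it, and these bounds are
again the two strip conditions. -/
theorem swapRow_bounds (hα : IsHorizontalStrip α ν) (hβ : IsHorizontalStrip ν β) (i : ℕ) :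
    max (α.rowLen i) (β.rowLen (i + 1)) ≤ swapRow α β ν i ∧ swapRow α β ν i ≤ β.rowLen i ∧
      swapRow α β ν (i + 1) ≤ α.rowLen i := by
  have := hα.lower i
  have := hβ.lower i
  have := hα.upper i
  have := hβ.upper i
  have := hα.lower (i + 1)
  have := hβ.lower (i + 1)
  have := hα.upper (i + 1)
  have := hβ.upper (i + 1)
  cases i with
  | zero =>
    simp only [swapRow, zero_add, Nat.reduceAdd] at *
    omega
  | succ i =>
    have := hα.upper i
    have := hβ.upper i
    simp only [swapRow, Nat.add_assoc, Nat.reduceAdd] at *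
    omega

theorem antitone_swapRow (hα : IsHorizontalStrip α ν) (hβ : IsHorizontalStrip ν β) :
    Antitone (swapRow α β ν) := by
  refine antitone_nat_of_succ_le fun i => ?_
  have := swapRow_bounds hα hβ i
  omega

theorem exists_swapRow_eq_zero (hα : IsHorizontalStrip α ν) (hβ : IsHorizontalStrip ν β) :
    ∃ M, swapRow α β ν M = 0 := by
  obtain ⟨B, hB⟩ := β.exists_rowLen_eq_zero
  have := swapRow_bounds hα hβ B
  exact ⟨B, by omega⟩

/-- The Bender--Knuth reflection of `ν` between `α` and `β`. -/
noncomputable def swapDiagram (hα : IsHorizontalStrip α ν) (hβ : IsHorizontalStrip ν β) :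
    YoungDiagram :=
  ofRowLen _ (antitone_swapRow hα hβ) _ (exists_swapRow_eq_zero hα hβ).choose_spec

theorem rowLen_swapDiagram (hα : IsHorizontalStrip α ν) (hβ : IsHorizontalStrip ν β) (i : ℕ) :
    (swapDiagram hα hβ).rowLen i = swapRow α β ν i := rowLen_ofRowLen ..

theorem isHorizontalStrip_swapDiagram (hα : IsHorizontalStrip α ν) (hβ : IsHorizontalStrip ν β) :
    IsHorizontalStrip α (swapDiagram hα hβ) ∧ IsHorizontalStrip (swapDiagram hα hβ) β := by
  constructor
  all_goals
    refine isHorizontalStrip_iff.2 fun i => ?_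
    have := swapRow_bounds hα hβ i
    simp only [rowLen_swapDiagram]
    omega

theorem swapDiagram_swapDiagram (hα : IsHorizontalStrip α ν) (hβ : IsHorizontalStrip ν β)
    (hα' : IsHorizontalStrip α (swapDiagram hα hβ))
    (hβ' : IsHorizontalStrip (swapDiagram hα hβ) β) : swapDiagram hα' hβ' = ν := by
  refine ext_rowLen fun i => ?_
  rw [rowLen_swapDiagram]
  have := hα.lower i
  have := hβ.lower i
  have := hβ.upper i
  cases i with
  | zero =>
    simp only [swapRow, rowLen_swapDiagram, zero_add] at *
    omega
  | succ i =>
    have := hα.upper i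
    simp only [swapRow, rowLen_swapDiagram] at *
    omega

/-- The effect is that the sizes of the strips β/ν and ν/α are interchanged. -/
theorem card_swapDiagram (hα : IsHorizontalStrip α ν) (hβ : IsHorizontalStrip ν β) :
    (swapDiagram hα hβ).card + ν.card = α.card + β.card := by
  obtain ⟨M, hM⟩ := β.exists_rowLen_eq_zero
  have h1 := rowLen_eq_zero_of_le (Nat.le_succ M) hM
  have h2 : ν.rowLen (M + 1) = 0 := Nat.le_zero.1 (h1 ▸ hβ.lower (M + 1))
  have h3 : α.rowLen (M + 1) = 0 := Nat.le_zero.1 (h2 ▸ hα.lower (M + 1))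
  have h4 : (swapDiagram hα hβ).rowLen (M + 1) = 0 :=
    Nat.le_zero.1 (h1 ▸ (isHorizontalStrip_swapDiagram hα hβ).2.lower (M + 1))
  rw [card_eq_sum_rowLen h1, card_eq_sum_rowLen h2, card_eq_sum_rowLen h3, card_eq_sum_rowLen h4]
  -- The max of α_i and β_{i+1} in row i is completed by their min in row i + 1. The boundary terms
  -- at m account for the pair not yet completed; both vanish at m = M.
  have key : ∀ m, ∑ i ∈ Finset.range (m + 1), (swapDiagram hα hβ).rowLen i +
      ∑ i ∈ Finset.range (m + 1), ν.rowLen i + min (α.rowLen m) (β.rowLen (m + 1)) =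
      ∑ i ∈ Finset.range (m + 1), α.rowLen i + ∑ i ∈ Finset.range (m + 1), β.rowLen i +
        β.rowLen (m + 1) := by
    intro m
    induction m with
    | zero =>
      have := hβ.lower 0
      simp [rowLen_swapDiagram, swapRow]
      omega
    | succ m ih =>
      rw [Finset.sum_range_succ, Finset.sum_range_succ _ (m + 1), Finset.sum_range_succ _ (m + 1),
        Finset.sum_range_succ _ (m + 1), rowLen_swapDiagram _ _ (m + 1)]
      have := hβ.lower (m + 1)
      have := hα.upper m
      simp only [swapRow, Nat.add_assoc, Nat.reduceAdd] at *
      omega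
  have := key M
  simp only [Nat.succ_eq_add_one] at *
  omega

end LocalRules

/-! ### Summability and orders of power series -/

namespace MvPowerSeries

theorem summable_of_finite_coeff_ne_zero {ι : Type*} {f : ι → MvPowerSeries ℕ ℤ}
    (h : ∀ e, {i | coeff e (f i) ≠ 0}.Finite) : Summable f :=
  WithPiTopology.summable_iff_summable_coeff.2 fun e => summable_of_hasFiniteSupport (h e)

theorem summable_of_le_order {ι : Type*} {f : ι → MvPowerSeries ℕ ℤ} (D : ι → ℕ)
    (hD : ∀ i, (D i : ℕ∞) ≤ (f i).order) (h : ∀ n, {i | D i ≤ n ∧ f i ≠ 0}.Finite) :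
    Summable f := by
  refine summable_of_finite_coeff_ne_zero fun e => (h (Finsupp.degree e)).subset fun i hi => ⟨?_, ?_⟩
  · by_contra! hlt
    exact hi (coeff_of_lt_order (lt_of_lt_of_le (by exact_mod_cast hlt) (hD i)))
  · rintro h0
    simp [h0] at hi

theorem le_order_mul_of_le {f g : MvPowerSeries ℕ ℤ} {m n : ℕ} (hf : (m : ℕ∞) ≤ f.order)
    (hg : (n : ℕ∞) ≤ g.order) : ((m + n : ℕ) : ℕ∞) ≤ (f * g).order := by
  push_cast
  exact (add_le_add hf hg).trans le_order_mul

theorem le_order_sum {ι : Type*} {s : Finset ι} {f : ι → MvPowerSeries ℕ ℤ} {n : ℕ∞}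
    (h : ∀ i ∈ s, n ≤ (f i).order) : n ≤ (∑ i ∈ s, f i).order := by
  refine le_order fun d hd => ?_
  rw [map_sum]
  exact Finset.sum_eq_zero fun i hi => coeff_of_lt_order (hd.trans_le (h i hi))

theorem le_order_X_pow (a n : ℕ) : (n : ℕ∞) ≤ ((X a : MvPowerSeries ℕ ℤ) ^ n).order := by
  rw [X_pow_eq, order_monomial_of_ne_zero one_ne_zero]
  simp

end MvPowerSeries

open MvPowerSeries

/-! ### Commutation of adding and removing strips -/

theorem one_sub_mul_littlewoodFactor (i j : ℕ) :
    (1 - X i * X j) * littlewoodFactor i j = 1 :=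
  mul_invOfUnit _ 1 (by simp)

theorem hasSum_pow_littlewoodFactor (i j : ℕ) :
    HasSum (fun k : ℕ => (X i * X j : MvPowerSeries ℕ ℤ) ^ k) (littlewoodFactor i j) := by
  have hc : constantCoeff (X i * X j : MvPowerSeries ℕ ℤ) = 0 := by simp
  have h := WithPiTopology.tsum_pow_mul_one_sub_of_constantCoeff_eq_zero hc
  have h2 : ∑' k : ℕ, (X i * X j : MvPowerSeries ℕ ℤ) ^ k = littlewoodFactor i j := by
    calc _ = (∑' k : ℕ, (X i * X j : MvPowerSeries ℕ ℤ) ^ k) *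
          ((1 - X i * X j) * littlewoodFactor i j) := by
          rw [one_sub_mul_littlewoodFactor, mul_one]
      _ = _ := by rw [← mul_assoc, h, one_mul]
  rw [← h2]
  exact (WithPiTopology.summable_pow_of_constantCoeff_eq_zero hc).hasSum

theorem littlewoodFactor_comm (i j : ℕ) : littlewoodFactor i j = littlewoodFactor j i := by
  rw [littlewoodFactor, littlewoodFactor, mul_comm (X i)]

open Classical in
/-- The weight of adding a horizontal strip with all entries equal to `a`. -/
noncomputable def stripWeight (a : ℕ) (ν μ : YoungDiagram) : MvPowerSeries ℕ ℤ :=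
  if IsHorizontalStrip ν μ then X a ^ (μ.card - ν.card) else 0

theorem stripWeight_of_strip (a : ℕ) {ν μ : YoungDiagram} (h : IsHorizontalStrip ν μ) :
    stripWeight a ν μ = X a ^ (μ.card - ν.card) := if_pos h

theorem stripWeight_of_not_strip (a : ℕ) {ν μ : YoungDiagram} (h : ¬ IsHorizontalStrip ν μ) :
    stripWeight a ν μ = 0 := if_neg h

theorem stripWeight_of_not_le (a : ℕ) {ν μ : YoungDiagram} (h : ¬ ν ≤ μ) :
    stripWeight a ν μ = 0 := if_neg fun hs => h hs.le

theorem le_order_stripWeight_mul (a : ℕ) (ν μ : YoungDiagram) {f : MvPowerSeries ℕ ℤ}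
    (hf : (ν.card : ℕ∞) ≤ f.order) : (μ.card : ℕ∞) ≤ (stripWeight a ν μ * f).order := by
  by_cases h : IsHorizontalStrip ν μ
  · rw [stripWeight_of_strip a h]
    refine le_trans ?_ (le_order_mul_of_le (le_order_X_pow a _) hf)
    exact_mod_cast (by omega)
  · simp [stripWeight_of_not_strip a h]

/-- This is `localRule` with weights. If γ corresponds to (k, δ), then |γ/α| = k + |β/δ| and |γ/β| =
k + |α/δ|, so k contributes (x_a x_b)^k and the sum over k is geometric. -/
theorem hasSum_stripWeight_mul_stripWeight (a b : ℕ) (α β : YoungDiagram) :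
    HasSum (fun γ => stripWeight a α γ * stripWeight b β γ)
      (littlewoodFactor a b * ∑ δ ∈ below α, stripWeight b δ α * stripWeight a δ β) := by
  classical
  set F : ℕ × {δ : YoungDiagram // IsHorizontalStrip δ α ∧ IsHorizontalStrip δ β} →
    MvPowerSeries ℕ ℤ := fun p =>
      (X a * X b) ^ p.1 * (stripWeight b p.2.1 α * stripWeight a p.2.1 β) with hF
  have hfin : Finite {δ : YoungDiagram // IsHorizontalStrip δ α ∧ IsHorizontalStrip δ β} :=
    Set.Finite.subset (below α).finite_toSet fun δ h => by simpa using h.1.le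
  have : Fintype {δ : YoungDiagram // IsHorizontalStrip δ α ∧ IsHorizontalStrip δ β} :=
    Fintype.ofFinite _
  have h1 : HasSum F (littlewoodFactor a b *
      ∑ δ : {δ : YoungDiagram // IsHorizontalStrip δ α ∧ IsHorizontalStrip δ β},
        (stripWeight b δ.1 α * stripWeight a δ.1 β)) := by
    -- There are finitely many δ, and the term for k has order at least k.
    have hs : Summable F := by
      rw [← (Equiv.prodComm _ _).summable_iff]
      refine summable_of_finite_coeff_ne_zero fun e => ?_
      refine (Set.finite_univ.prod (Set.finite_le_nat (Finsupp.degree e))).subset ?_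
      rintro ⟨δ, k⟩ hk
      refine ⟨trivial, ?_⟩
      by_contra hlt
      refine hk (coeff_of_lt_order ?_)
      simp only [Set.mem_ofPred_eq, not_le] at hlt
      have := le_order_mul_of_le (f := (X a * X b) ^ k) (m := k) (n := 0)
        (g := stripWeight b δ.1 α * stripWeight a δ.1 β)
        (by
          rw [mul_pow]
          exact_mod_cast le_order_mul_of_le (n := 0) (le_order_X_pow a k) (by simp)) (by simp)
      exact lt_of_lt_of_le (by exact_mod_cast hlt) this
    have h2 := hs.hasSum.prod_fiberwise fun k => hasSum_fintype (fun δ => F (k, δ))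
    have h3 := (hasSum_pow_littlewoodFactor a b).mul_right
      (∑ δ : {δ : YoungDiagram // IsHorizontalStrip δ α ∧ IsHorizontalStrip δ β},
        (stripWeight b δ.1 α * stripWeight a δ.1 β))
    simp only [Finset.mul_sum] at h3
    simp only [Finset.mul_sum]
    rw [← h2.unique h3]
    exact hs.hasSum
  have h2 : ∑ δ : {δ : YoungDiagram // IsHorizontalStrip δ α ∧ IsHorizontalStrip δ β},
        (stripWeight b δ.1 α * stripWeight a δ.1 β) =
      ∑ δ ∈ below α, stripWeight b δ α * stripWeight a δ β := by
    rw [← Finset.sum_filter_of_ne (p := fun δ => IsHorizontalStrip δ α ∧ IsHorizontalStrip δ β)]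
    · refine (Finset.sum_subtype _ (fun δ => ?_)
        fun δ => stripWeight b δ α * stripWeight a δ β).symm
      simp only [Finset.mem_filter, mem_below, and_iff_right_iff_imp]
      exact fun h => h.1.le
    · intro δ _ hne
      by_contra hn
      apply hne
      rcases not_and_or.1 hn with h | h <;> simp [stripWeight_of_not_strip _ h]
  rw [← h2]
  rw [← (localRule α β).hasSum_iff] at h1
  refine (hasSum_subtype_iff_of_support_subset
    (s := {γ | IsHorizontalStrip α γ ∧ IsHorizontalStrip β γ}) ?_).1 ?_
  · intro γ hγ
    by_contra hn
    apply hγ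
    rcases not_and_or.1 hn with h | h <;> simp [stripWeight_of_not_strip _ h]
  · refine h1.congr_fun ?_
    intro γ
    obtain ⟨p, rfl⟩ := (localRule α β).symm.surjective γ
    obtain ⟨k, δ, hα, hβ⟩ := p
    have hc := card_upperDiagram α β k hα hβ
    have hs := ((localRule α β).symm (k, ⟨δ, hα, hβ⟩)).2
    have hv : ((localRule α β).symm (k, ⟨δ, hα, hβ⟩)).1 = upperDiagram α β k hα hβ := rfl
    simp only [Function.comp_apply, Equiv.apply_symm_apply, hF]
    rw [hv] at hs ⊢
    rw [stripWeight_of_strip a hs.1, stripWeight_of_strip b hs.2, stripWeight_of_strip b hα,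
      stripWeight_of_strip a hβ]
    have h1 := card_le_card hα.le
    have h2 := card_le_card hβ.le
    rw [show (upperDiagram α β k hα hβ).card - α.card = k + (β.card - δ.card) by omega,
      show (upperDiagram α β k hα hβ).card - β.card = k + (α.card - δ.card) by omega]
    ring

/-- The Bender--Knuth reflection of ν between α and β is an involution that exchanges the two
exponents. -/
theorem sum_stripWeight_mul_stripWeight_comm (a b : ℕ) (α β : YoungDiagram) :
    ∑ ν ∈ below β, stripWeight a ν β * stripWeight b α ν =
      ∑ ν ∈ below β, stripWeight b ν β * stripWeight a α ν := by
  classical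
  have key : ∀ a b : ℕ, ∑ ν ∈ below β, stripWeight a ν β * stripWeight b α ν =
      ∑ ν ∈ (below β).filter fun ν => IsHorizontalStrip α ν ∧ IsHorizontalStrip ν β,
        X a ^ (β.card - ν.card) * X b ^ (ν.card - α.card) := by
    intro a b
    rw [Finset.sum_filter]
    refine Finset.sum_congr rfl fun ν _ => ?_
    split_ifs with h
    · rw [stripWeight_of_strip a h.2, stripWeight_of_strip b h.1]
    · rcases not_and_or.1 h with h | h <;> simp [stripWeight_of_not_strip _ h]
  rw [key, key]
  have hmem : ∀ {ν}, ν ∈ (below β).filter (fun ν => IsHorizontalStrip α ν ∧ IsHorizontalStrip ν β) ↔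
      IsHorizontalStrip α ν ∧ IsHorizontalStrip ν β := by
    intro ν
    simp only [Finset.mem_filter, mem_below, and_iff_right_iff_imp]
    exact fun h => h.2.le
  refine Finset.sum_bij' (fun ν h => swapDiagram (hmem.1 h).1 (hmem.1 h).2)
    (fun ν h => swapDiagram (hmem.1 h).1 (hmem.1 h).2)
    (fun ν h => hmem.2 (isHorizontalStrip_swapDiagram _ _))
    (fun ν h => hmem.2 (isHorizontalStrip_swapDiagram _ _))
    (fun ν h => swapDiagram_swapDiagram _ _ _ _) (fun ν h => swapDiagram_swapDiagram _ _ _ _) ?_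
  intro ν h
  obtain ⟨hα, hβ⟩ := hmem.1 h
  have h1 := card_swapDiagram hα hβ
  have h2 := card_le_card hα.le
  have h3 := card_le_card hβ.le
  rw [show β.card - (swapDiagram hα hβ).card = ν.card - α.card by omega,
    show (swapDiagram hα hβ).card - α.card = β.card - ν.card by omega, mul_comm]

/-! ### Schur polynomials by the branching rule -/

open Classical in
/-- The Schur polynomial of a list of variables, defined by the branching rule. -/
noncomputable def schurList : List ℕ → YoungDiagram → MvPowerSeries ℕ ℤ
  | [], μ => if μ = ⊥ then 1 else 0
  | a :: l, μ => ∑ ν ∈ below μ, stripWeight a ν μ * schurList l ν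

/-- This degree bound makes sums over arbitrarily large diagrams converge. -/
theorem le_order_schurList (l : List ℕ) (μ : YoungDiagram) :
    (μ.card : ℕ∞) ≤ (schurList l μ).order := by
  induction l generalizing μ with
  | nil =>
    rw [schurList]
    split_ifs with h
    · simp [h, YoungDiagram.card]
    · simp
  | cons a l ih => exact le_order_sum fun ν _ => le_order_stripWeight_mul a ν μ (ih ν)

theorem schurList_perm {l l' : List ℕ} (h : l.Perm l') : schurList l = schurList l' := by
  classical
  induction h with
  | nil => rfl
  | cons a _ ih => funext μ; simp only [schurList, ih]
  | trans _ _ ih1 ih2 => exact ih1.trans ih2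
  | swap a b l =>
    funext μ
    have key : ∀ a b : ℕ, schurList (a :: b :: l) μ = ∑ ρ ∈ below μ,
        (∑ ν ∈ below μ, stripWeight a ν μ * stripWeight b ρ ν) * schurList l ρ := by
      intro a b
      simp only [schurList, Finset.sum_mul]
      rw [Finset.sum_comm]
      refine Finset.sum_congr rfl fun ν hν => ?_
      rw [Finset.mul_sum]
      -- The range ρ ≤ ν is enlarged to ρ ≤ μ, independent of ν; the new terms vanish.
      refine Finset.sum_subset_zero_on_sdiff (fun ρ hρ => ?_) (fun ρ hρ => ?_) fun ρ _ => by ring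
      · rw [mem_below] at *
        exact hρ.trans hν
      · rw [Finset.mem_sdiff, mem_below, mem_below] at hρ
        simp [stripWeight_of_not_le b hρ.2]
    rw [key, key]
    refine Finset.sum_congr rfl fun ρ _ => ?_
    rw [sum_stripWeight_mul_stripWeight_comm]

/-- The removal with letter `m` is moved past the letters of `l` one at a time, each costing one
Littlewood factor. For the empty list only κ = ∅ contributes, which forces ν = ∅. -/
theorem hasSum_stripWeight_mul_schurList (m : ℕ) (l : List ℕ) (ν : YoungDiagram) :
    HasSum (fun κ => stripWeight m ν κ * schurList l κ)
      ((l.map fun i => littlewoodFactor i m).prod * schurList l ν) := by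
  classical
  induction l generalizing ν with
  | nil =>
    simp only [schurList, List.map_nil, List.prod_nil, one_mul]
    have h := hasSum_single (f := fun κ => stripWeight m ν κ *
      (if κ = ⊥ then 1 else 0 : MvPowerSeries ℕ ℤ)) ⊥ fun κ hκ => by simp [hκ]
    convert h using 1
    by_cases hν : ν = ⊥
    · subst hν
      simp [stripWeight_of_strip m (IsHorizontalStrip.refl ⊥)]
    · simp [hν, stripWeight_of_not_le m (fun h => hν (le_bot_iff.1 h))]
  | cons a l ih =>
    set f : YoungDiagram × YoungDiagram → MvPowerSeries ℕ ℤ := fun p =>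
      stripWeight m ν p.1 * (stripWeight a p.2 p.1 * schurList l p.2) with hf
    -- Nonzero terms have ρ ≤ κ and order at least |κ|, so each degree meets finitely many pairs.
    have hs : Summable f := by
      refine summable_of_le_order (fun p => p.1.card) (fun p => ?_) fun n => ?_
      · simpa using le_order_mul_of_le (m := 0) (f := stripWeight m ν p.1) (by simp)
          (le_order_stripWeight_mul a p.2 p.1 (le_order_schurList l p.2))
      · refine ((finite_setOf_card_le n).prod (finite_setOf_card_le n)).subset ?_
        rintro ⟨κ, ρ⟩ ⟨h1, h2⟩
        refine ⟨h1, ?_⟩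
        by_cases hle : ρ ≤ κ
        · exact (card_le_card hle).trans h1
        · simp [hf, stripWeight_of_not_le a hle] at h2
    have h1 : HasSum (fun κ => stripWeight m ν κ * schurList (a :: l) κ) (∑' p, f p) := by
      refine hs.hasSum.prod_fiberwise fun κ => ?_
      simp only [schurList, Finset.mul_sum]
      exact hasSum_sum_of_ne_finset_zero fun ρ hρ => by
        rw [mem_below] at hρ
        simp [hf, stripWeight_of_not_le a hρ]
    -- The same double sum with κ summed first: for fixed ρ, the commutation relation replaces the
    -- upper diagram κ by a lower diagram δ.
    have h2 : HasSum (fun ρ => littlewoodFactor a m *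
        ∑ δ ∈ below ν, stripWeight a δ ν * stripWeight m δ ρ * schurList l ρ) (∑' p, f p) := by
      have hs' := (Equiv.prodComm YoungDiagram YoungDiagram).hasSum_iff.2 hs.hasSum
      refine hs'.prod_fiberwise fun ρ => ?_
      have := (hasSum_stripWeight_mul_stripWeight m a ν ρ).mul_right (schurList l ρ)
      simp only [Finset.sum_mul, mul_assoc, littlewoodFactor_comm m a] at this ⊢
      exact this
    have h3 : HasSum (fun ρ => littlewoodFactor a m *
        ∑ δ ∈ below ν, stripWeight a δ ν * stripWeight m δ ρ * schurList l ρ)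
        (littlewoodFactor a m * ∑ δ ∈ below ν, stripWeight a δ ν *
          ((l.map fun i => littlewoodFactor i m).prod * schurList l δ)) := by
      refine HasSum.mul_left _ (hasSum_sum fun δ _ => ?_)
      simp only [mul_assoc]
      exact (ih δ).mul_left _
    rw [h2.unique h3] at h1
    convert h1 using 1
    simp only [schurList, List.map_cons, List.prod_cons, Finset.mul_sum]
    exact Finset.sum_congr rfl fun δ _ => by ring

/-! ### Semistandard tableaux and the branching rule -/

/-- `f` is the entry function of a semistandard Young tableau of shape `μ` with entries
smaller than `N`. -/
structure IsTableau (N : ℕ) (μ : YoungDiagram) (f : ℕ → ℕ → ℕ) : Prop where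
  row_weak : ∀ {i j1 j2 : ℕ}, j1 < j2 → (i, j2) ∈ μ → f i j1 ≤ f i j2
  col_strict : ∀ {i1 i2 j : ℕ}, i1 < i2 → (i2, j) ∈ μ → f i1 j < f i2 j
  zeros : ∀ {i j}, (i, j) ∉ μ → f i j = 0
  lt : ∀ {i j}, (i, j) ∈ μ → f i j < N

/-- The exponent vector of the weight monomial of a filling of `μ`. -/
noncomputable def fillingWeight (μ : YoungDiagram) (f : ℕ → ℕ → ℕ) : ℕ →₀ ℕ :=
  ∑ b ∈ μ.cells, Finsupp.single (f b.1 b.2) 1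

theorem finite_setOf_isTableau (N : ℕ) (μ : YoungDiagram) : {f | IsTableau N μ f}.Finite := by
  refine Set.Finite.of_finite_image (f := fun f (b : μ.cells) => f b.1.1 b.1.2)
    ((Set.Finite.pi' fun _ => Set.finite_lt_nat N).subset ?_) ?_
  · rintro _ ⟨f, hf, rfl⟩ ⟨b, hb⟩
    exact hf.lt hb
  · intro f hf g hg h
    funext i j
    by_cases hb : (i, j) ∈ μ
    · exact congrFun h ⟨(i, j), hb⟩
    · rw [hf.zeros hb, hg.zeros hb]

namespace IsTableau

variable {N : ℕ} {μ : YoungDiagram} {f : ℕ → ℕ → ℕ}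

theorem le_of_le (hf : IsTableau N μ f) {i i' j j' : ℕ} (hi : i ≤ i') (hj : j ≤ j')
    (hb : (i', j') ∈ μ) : f i j ≤ f i' j' := by
  have h1 : f i j ≤ f i j' := by
    rcases hj.eq_or_lt with rfl | h
    · rfl
    · exact hf.row_weak h (μ.up_left_mem hi le_rfl hb)
  refine h1.trans ?_
  rcases hi.eq_or_lt with rfl | h
  · rfl
  · exact (hf.col_strict h hb).le

/-- The diagram of the entries smaller than `N`. -/
def shapeLT (hf : IsTableau (N + 1) μ f) : YoungDiagram where
  cells := μ.cells.filter fun b => f b.1 b.2 < N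
  isLowerSet := by
    rintro ⟨i', j'⟩ ⟨i, j⟩ ⟨hi, hj⟩ hb
    simp only [Finset.coe_filter, Set.mem_ofPred_eq, mem_cells] at hb ⊢
    exact ⟨μ.up_left_mem hi hj hb.1, (hf.le_of_le hi hj hb.1).trans_lt hb.2⟩

theorem mem_shapeLT (hf : IsTableau (N + 1) μ f) {b : ℕ × ℕ} :
    b ∈ hf.shapeLT ↔ b ∈ μ ∧ f b.1 b.2 < N := by
  rw [← mem_cells]
  simp [shapeLT]

/-- All boxes outside the smaller shape carry the entry `N`, which a strictly increasing column
contains at most once. -/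
theorem isHorizontalStrip_shapeLT (hf : IsTableau (N + 1) μ f) :
    IsHorizontalStrip hf.shapeLT μ := by
  have key : ∀ i i' j, (i', j) ∈ μ → (i, j) ∈ μ → (i, j) ∉ hf.shapeLT → ¬ i < i' := by
    intro i i' j h1 h2 h3 hlt
    have h4 := hf.col_strict hlt h1
    have h5 := hf.lt h1
    rw [mem_shapeLT] at h3
    exact h3 ⟨h2, by simp only; omega⟩
  refine ⟨fun b hb => (hf.mem_shapeLT.1 hb).1, ?_⟩
  rintro ⟨i, j⟩ hb ⟨i', j'⟩ hc hj
  simp only [Finset.mem_sdiff, mem_cells] at hb hc hj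
  subst hj
  have := key i i' j hc.1 hb.1 hb.2
  have := key i' i j hb.1 hc.1 hc.2
  rw [show i = i' by omega]

theorem restrict (hf : IsTableau (N + 1) μ f) :
    IsTableau N hf.shapeLT fun i j => if (i, j) ∈ hf.shapeLT then f i j else 0 where
  row_weak {i j1 j2} hj hb := by
    have hb' := hf.shapeLT.up_left_mem le_rfl hj.le hb
    simp only [hb, hb', if_true]
    exact hf.row_weak hj (hf.mem_shapeLT.1 hb).1
  col_strict {i1 i2 j} hi hb := by
    have hb' := hf.shapeLT.up_left_mem hi.le le_rfl hb
    simp only [hb, hb', if_true]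
    exact hf.col_strict hi (hf.mem_shapeLT.1 hb).1
  zeros hb := if_neg hb
  lt hb := by
    simp only [hb, if_true]
    exact (hf.mem_shapeLT.1 hb).2

end IsTableau

/-- Fill the boxes of `μ` outside `ν` with the entry `N`. -/
def extendFilling (N : ℕ) (ν μ : YoungDiagram) (f : ℕ → ℕ → ℕ) (i j : ℕ) : ℕ :=
  if (i, j) ∈ ν then f i j else if (i, j) ∈ μ then N else 0

theorem IsTableau.extend {N : ℕ} {ν μ : YoungDiagram} {f : ℕ → ℕ → ℕ} (hf : IsTableau N ν f)
    (h : IsHorizontalStrip ν μ) : IsTableau (N + 1) μ (extendFilling N ν μ f) where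
  row_weak {i j1 j2} hj hb := by
    have hb' := μ.up_left_mem le_rfl hj.le hb
    simp only [extendFilling, hb, hb', if_true]
    split_ifs with h1 h2 h2
    · exact hf.row_weak hj h2
    · exact (hf.lt h1).le
    · exact absurd (ν.up_left_mem le_rfl hj.le h2) h1
    · rfl
  col_strict {i1 i2 j} hi hb := by
    have hb' := μ.up_left_mem hi.le le_rfl hb
    simp only [extendFilling, hb, hb', if_true]
    split_ifs with h1 h2 h2
    · exact hf.col_strict hi h2
    · exact hf.lt h1
    · exact absurd (ν.up_left_mem hi.le le_rfl h2) h1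
    · have := h.2 (i1, j) (by simp [h1, hb']) (i2, j) (by simp [h2, hb]) rfl
      simp only [Prod.mk.injEq, and_true] at this
      omega
  zeros {i j} hb := by
    have : (i, j) ∉ ν := fun hn => hb (h.le hn)
    simp [extendFilling, hb, this]
  lt {i j} hb := by
    simp only [extendFilling, hb, if_true]
    split_ifs with h1
    · exact (hf.lt h1).trans N.lt_succ_self
    · exact N.lt_succ_self

theorem fillingWeight_extendFilling (N : ℕ) {ν μ : YoungDiagram} (f : ℕ → ℕ → ℕ) (h : ν ≤ μ) :
    fillingWeight μ (extendFilling N ν μ f) =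
      Finsupp.single N (μ.card - ν.card) + fillingWeight ν f := by
  rw [fillingWeight, ← Finset.sum_sdiff (cells_subset_iff.2 h), fillingWeight]
  congr 1
  · rw [← card_sdiff_cells h, Finset.sum_congr rfl (g := fun _ => Finsupp.single N 1)]
    · simp
    · rintro ⟨i, j⟩ hb
      simp only [Finset.mem_sdiff, mem_cells] at hb
      simp [extendFilling, hb.1, hb.2]
  · refine Finset.sum_congr rfl ?_
    rintro ⟨i, j⟩ hb
    rw [mem_cells] at hb
    simp [extendFilling, hb]

/-- Removing the largest entries of a tableau. -/
def tableauEquiv (N : ℕ) (μ : YoungDiagram) :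
    (Σ ν : {ν | IsHorizontalStrip ν μ}, {f // IsTableau N ν.1 f}) ≃
      {f // IsTableau (N + 1) μ f} where
  toFun p := ⟨extendFilling N p.1.1 μ p.2.1, p.2.2.extend p.1.2⟩
  invFun f := ⟨⟨f.2.shapeLT, f.2.isHorizontalStrip_shapeLT⟩, ⟨_, f.2.restrict⟩⟩
  left_inv := by
    rintro ⟨⟨ν, hν⟩, ⟨f, hf⟩⟩
    have key : (hf.extend hν).shapeLT = ν := by
      ext ⟨i, j⟩
      rw [mem_cells, mem_cells, IsTableau.mem_shapeLT]
      simp only [extendFilling]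
      constructor
      · rintro ⟨h1, h2⟩
        by_contra hn
        simp [h1, hn] at h2
      · intro h
        simpa [h, hν.le h] using hf.lt h
    refine Sigma.subtype_ext (Subtype.ext key) ?_
    funext i j
    simp only [key, extendFilling]
    split_ifs with h
    · rfl
    · exact (hf.zeros h).symm
  right_inv := by
    rintro ⟨f, hf⟩
    refine Subtype.ext ?_
    funext i j
    simp only [extendFilling, hf.mem_shapeLT]
    split_ifs with h1 h2
    · rfl
    · have := hf.lt h2
      have h3 := not_and.1 h1 h2
      omega
    · exact (hf.zeros h2).symm

/-- Stripping off the boxes with the largest entry is one step of the branching rule. The list is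
reversed so that the largest letter stands at its head. -/
theorem hasSum_isTableau (N : ℕ) (μ : YoungDiagram) :
    HasSum (fun f : {f // IsTableau N μ f} => monomial (fillingWeight μ f.1) (1 : ℤ))
      (schurList (List.range N).reverse μ) := by
  classical
  induction N generalizing μ with
  | zero =>
    simp only [List.range_zero, List.reverse_nil, schurList]
    split_ifs with h
    · subst h
      have : Unique {f // IsTableau 0 ⊥ f} :=
        { default := ⟨fun _ _ => 0, ⟨fun _ _ => le_rfl, fun _ h => absurd h (notMem_bot _),
            fun _ => rfl, fun h => absurd h (notMem_bot _)⟩⟩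
          uniq := fun f => Subtype.ext (by
            funext i j
            exact f.2.zeros (notMem_bot _)) }
      have h1 : monomial (fillingWeight ⊥ (default : {f // IsTableau 0 ⊥ f}).1) (1 : ℤ) = 1 := by
        simp [fillingWeight]
      rw [← h1]
      exact hasSum_unique _
    · have : IsEmpty {f // IsTableau 0 μ f} := by
        refine ⟨fun f => h (le_bot_iff.1 fun b hb => ?_)⟩
        exact absurd (f.2.lt hb) (Nat.not_lt_zero _)
      exact hasSum_empty
  | succ N ih =>
    have : Finite {f // IsTableau (N + 1) μ f} := finite_setOf_isTableau (N + 1) μ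
    have hs : Summable fun f : {f // IsTableau (N + 1) μ f} =>
      monomial (fillingWeight μ f.1) (1 : ℤ) := Summable.of_finite
    have h := hs.hasSum
    rw [← (tableauEquiv N μ).hasSum_iff] at h
    have h1 := h.sigma (g := fun ν => stripWeight N ν.1 μ * schurList (List.range N).reverse ν.1)
      fun ν => by
        refine ((ih ν.1).mul_left (stripWeight N ν.1 μ)).congr_fun fun f => ?_
        rw [stripWeight_of_strip N ν.2, X_pow_eq, monomial_mul_monomial, one_mul,
          ← fillingWeight_extendFilling N f.1 ν.2.le]
        rfl
    have h2 := (hasSum_subtype_iff_of_support_subset (s := {ν | IsHorizontalStrip ν μ})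
      (f := fun ν => stripWeight N ν μ * schurList (List.range N).reverse ν) (by
        intro ν hν
        by_contra hn
        exact hν (by simp [stripWeight_of_not_strip N hn]))).1 h1
    have h3 : HasSum (fun ν => stripWeight N ν μ * schurList (List.range N).reverse ν)
        (schurList (List.range (N + 1)).reverse μ) := by
      rw [List.range_succ, List.reverse_append]
      exact hasSum_sum_of_ne_finset_zero fun ν hν => by
        rw [mem_below] at hν
        simp [stripWeight_of_not_le N hν]
    rw [(tableauEquiv N μ).hasSum_iff] at h
    rwa [h2.unique h3] at h

/-! ### Oscillating sequences with finitely many steps -/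

/-- `p = (full, part)` is an oscillating sequence of shape `μ` that is constant from the step
with number `N + 1` on. -/
structure IsOscillating (N : ℕ) (μ : YoungDiagram)
    (p : (ℕ → YoungDiagram) × (ℕ → YoungDiagram)) : Prop where
  full_zero : p.1 0 = ⊥
  strip_removed : ∀ i, IsHorizontalStrip (p.2 i) (p.1 i)
  strip_added : ∀ i, IsHorizontalStrip (p.2 i) (p.1 (i + 1))
  full_eq : ∀ i, N ≤ i → p.1 i = μ
  part_eq : ∀ i, N ≤ i → p.2 i = μ

/-- The number of boxes removed or added in a step. -/
def oscStep (p : (ℕ → YoungDiagram) × (ℕ → YoungDiagram)) (i : ℕ) : ℕ :=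
  ((p.1 i).cells \ (p.2 i).cells).card + ((p.1 (i + 1)).cells \ (p.2 i).cells).card

/-- The exponent vector of the first `N` steps of an oscillating sequence. -/
noncomputable def oscWeight (N : ℕ) (p : (ℕ → YoungDiagram) × (ℕ → YoungDiagram)) : ℕ →₀ ℕ :=
  ∑ i ∈ Finset.range N, Finsupp.single i (oscStep p i)

theorem degree_oscWeight (N : ℕ) (p : (ℕ → YoungDiagram) × (ℕ → YoungDiagram)) :
    (oscWeight N p).degree = ∑ i ∈ Finset.range N, oscStep p i := by
  simp [oscWeight]

namespace IsOscillating

variable {N : ℕ} {μ : YoungDiagram} {p : (ℕ → YoungDiagram) × (ℕ → YoungDiagram)}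

theorem oscStep_eq (hp : IsOscillating N μ p) (i : ℕ) :
    oscStep p i = ((p.1 i).card - (p.2 i).card) + ((p.1 (i + 1)).card - (p.2 i).card) := by
  rw [oscStep, card_sdiff_cells (hp.strip_removed i).le, card_sdiff_cells (hp.strip_added i).le]

theorem card_le (hp : IsOscillating N μ p) (i : ℕ) :
    (p.1 i).card ≤ ∑ j ∈ Finset.range i, oscStep p j := by
  induction i with
  | zero => simp [hp.full_zero, YoungDiagram.card]
  | succ i ih =>
    rw [Finset.sum_range_succ, hp.oscStep_eq]
    have := card_le_card (hp.strip_removed i).le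
    omega

theorem card_le_degree (hp : IsOscillating N μ p) {i : ℕ} (hi : i ≤ N) :
    (p.1 i).card ≤ (oscWeight N p).degree := by
  rw [degree_oscWeight]
  exact (hp.card_le i).trans (Finset.sum_le_sum_of_subset (Finset.range_subset_range.2 hi))

end IsOscillating

/-- Every box present has been added in an earlier step, so the degree of the weight bounds the size
of all diagrams; the first `N` pairs determine the sequence. -/
theorem finite_setOf_isOscillating (N : ℕ) (μ : YoungDiagram) (e : ℕ →₀ ℕ) :
    {p | IsOscillating N μ p ∧ oscWeight N p = e}.Finite := by
  refine Set.Finite.of_finite_image (f := fun p (i : Fin N) => (p.1 i, p.2 i))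
    ((Set.Finite.pi' fun _ => (finite_setOf_card_le e.degree).prod
      (finite_setOf_card_le e.degree)).subset ?_) ?_
  · rintro _ ⟨p, ⟨hp, rfl⟩, rfl⟩ i
    have := hp.card_le_degree i.2.le
    exact ⟨this, (card_le_card (hp.strip_removed i).le).trans this⟩
  · rintro p ⟨hp, -⟩ q ⟨hq, -⟩ h
    have key : ∀ i, p.1 i = q.1 i ∧ p.2 i = q.2 i := by
      intro i
      rcases lt_or_ge i N with hi | hi
      · simpa using congrFun h ⟨i, hi⟩
      · rw [hp.full_eq i hi, hp.part_eq i hi, hq.full_eq i hi, hq.part_eq i hi]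
        exact ⟨rfl, rfl⟩
    exact Prod.ext (funext fun i => (key i).1) (funext fun i => (key i).2)

theorem summable_isOscillating (N : ℕ) (μ : YoungDiagram) :
    Summable fun p : {p // IsOscillating N μ p} => monomial (oscWeight N p.1) (1 : ℤ) := by
  classical
  refine summable_of_finite_coeff_ne_zero fun e => ?_
  refine Set.Finite.of_finite_image (f := Subtype.val)
    ((finite_setOf_isOscillating N μ e).subset ?_) Subtype.val_injective.injOn
  rintro _ ⟨p, hp, rfl⟩
  simp only [Set.mem_ofPred_eq, coeff_monomial, ne_eq, ite_eq_right_iff, one_ne_zero, imp_false,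
    not_not] at hp
  exact ⟨p.2, hp.symm⟩

/-- Prescribe the last step of an oscillating sequence. -/
def extendOsc (N : ℕ) (ν μ : YoungDiagram) (p : (ℕ → YoungDiagram) × (ℕ → YoungDiagram)) :
    (ℕ → YoungDiagram) × (ℕ → YoungDiagram) :=
  (fun i => if i ≤ N then p.1 i else μ, fun i => if i < N then p.2 i else if i = N then ν else μ)

/-- Forget the last step of an oscillating sequence. -/
def restrictOsc (N : ℕ) (p : (ℕ → YoungDiagram) × (ℕ → YoungDiagram)) :
    (ℕ → YoungDiagram) × (ℕ → YoungDiagram) :=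
  -- The diagram `p.2 N` belongs to the forgotten step and is replaced, whereas `p.1 N` is the shape
  -- reached before that step and is kept.
  (fun i => if i ≤ N then p.1 i else p.1 N, fun i => if i < N then p.2 i else p.1 N)

theorem IsOscillating.extend {N : ℕ} {ν κ μ : YoungDiagram}
    {p : (ℕ → YoungDiagram) × (ℕ → YoungDiagram)} (hp : IsOscillating N κ p)
    (hμ : IsHorizontalStrip ν μ) (hκ : IsHorizontalStrip ν κ) :
    IsOscillating (N + 1) μ (extendOsc N ν μ p) where
  full_zero := by simp [extendOsc, hp.full_zero]
  strip_removed i := by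
    simp only [extendOsc]
    rcases lt_trichotomy i N with h | rfl | h
    · simpa [h, h.le] using hp.strip_removed i
    · simpa [hp.full_eq] using hκ
    · simpa [h.not_ge, h.not_gt, h.ne'] using IsHorizontalStrip.refl μ
  strip_added i := by
    simp only [extendOsc]
    rcases lt_trichotomy i N with h | rfl | h
    · simpa [h, Nat.succ_le_of_lt h] using hp.strip_added i
    · simpa using hμ
    · simpa [h.not_gt, h.ne', (h.trans i.lt_succ_self).not_ge] using IsHorizontalStrip.refl μ
  full_eq i hi := by simp [extendOsc, show ¬ i ≤ N by omega]
  part_eq i hi := by simp [extendOsc, show ¬ i < N by omega, show ¬ i = N by omega]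

theorem IsOscillating.restrict {N : ℕ} {μ : YoungDiagram}
    {p : (ℕ → YoungDiagram) × (ℕ → YoungDiagram)} (hp : IsOscillating (N + 1) μ p) :
    IsOscillating N (p.1 N) (restrictOsc N p) where
  full_zero := by simp [restrictOsc, hp.full_zero]
  strip_removed i := by
    simp only [restrictOsc]
    rcases lt_or_ge i N with h | h
    · simpa [h, h.le] using hp.strip_removed i
    · rcases h.eq_or_lt with rfl | h
      · simpa using IsHorizontalStrip.refl _
      · simpa [h.not_ge, h.not_gt] using IsHorizontalStrip.refl _
  strip_added i := by
    simp only [restrictOsc]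
    rcases lt_or_ge i N with h | h
    · simpa [h, Nat.succ_le_of_lt h] using hp.strip_added i
    · simpa [h.not_gt, show ¬ i + 1 ≤ N by omega] using IsHorizontalStrip.refl _
  full_eq i hi := by
    simp only [restrictOsc]
    split_ifs with h
    · rw [le_antisymm h hi]
    · rfl
  part_eq i hi := by simp [restrictOsc, hi.not_gt]

theorem oscWeight_extendOsc {N : ℕ} {ν κ μ : YoungDiagram}
    {p : (ℕ → YoungDiagram) × (ℕ → YoungDiagram)} (hp : IsOscillating N κ p)
    (hμ : IsHorizontalStrip ν μ) (hκ : IsHorizontalStrip ν κ) :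
    oscWeight (N + 1) (extendOsc N ν μ p) =
      Finsupp.single N (μ.card - ν.card) + Finsupp.single N (κ.card - ν.card) + oscWeight N p := by
  rw [oscWeight, Finset.sum_range_succ, add_comm, oscWeight, (hp.extend hμ hκ).oscStep_eq,
    ← Finsupp.single_add]
  congr 1
  · simp [extendOsc, hp.full_eq, add_comm]
  · refine Finset.sum_congr rfl fun i hi => ?_
    rw [Finset.mem_range] at hi
    simp [oscStep, extendOsc, hi, hi.le, Nat.succ_le_of_lt hi]

/-- Splitting off the last step of an oscillating sequence. -/
def oscEquiv (N : ℕ) (μ : YoungDiagram) :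
    (Σ q : {q : YoungDiagram × YoungDiagram | IsHorizontalStrip q.1 μ ∧ IsHorizontalStrip q.1 q.2},
      {p // IsOscillating N q.1.2 p}) ≃ {p // IsOscillating (N + 1) μ p} where
  toFun r := ⟨extendOsc N r.1.1.1 μ r.2.1, r.2.2.extend r.1.2.1 r.1.2.2⟩
  invFun p := ⟨⟨(p.1.2 N, p.1.1 N), by
    have := p.2.strip_added N
    rw [p.2.full_eq _ le_rfl] at this
    exact ⟨this, p.2.strip_removed N⟩⟩, ⟨restrictOsc N p.1, p.2.restrict⟩⟩
  left_inv := by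
    rintro ⟨⟨⟨ν, κ⟩, hμ, hκ⟩, ⟨p, hp⟩⟩
    refine Sigma.subtype_ext (Subtype.ext (Prod.ext ?_ ?_)) (Prod.ext ?_ ?_)
    · simp [extendOsc]
    · simpa [extendOsc] using hp.full_eq N le_rfl
    · funext i
      rcases le_or_gt i N with h | h
      · simp [extendOsc, restrictOsc, h]
      · simp [extendOsc, restrictOsc, h.not_ge, hp.full_eq _ h.le, hp.full_eq _ le_rfl]
    · funext i
      rcases lt_or_ge i N with h | h
      · simp [extendOsc, restrictOsc, h]
      · simp [extendOsc, restrictOsc, h.not_gt, hp.part_eq _ h, hp.full_eq _ le_rfl]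
  right_inv := by
    rintro ⟨p, hp⟩
    refine Subtype.ext (Prod.ext ?_ ?_)
    · funext i
      rcases le_or_gt i N with h | h
      · simp [extendOsc, restrictOsc, h]
      · simp [extendOsc, h.not_ge, hp.full_eq _ h]
    · funext i
      rcases lt_trichotomy i N with h | rfl | h
      · simp [extendOsc, restrictOsc, h]
      · simp [extendOsc]
      · simp [extendOsc, h.not_gt, h.ne', hp.part_eq _ h]

/-- The product of the Littlewood factors of the first `N` variables. -/
noncomputable def littlewoodProd (N : ℕ) : MvPowerSeries ℕ ℤ :=
  ∏ j ∈ Finset.range N, ∏ i ∈ Finset.range j, littlewoodFactor i j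

theorem prod_map_reverse_range {R : Type*} [CommMonoid R] (f : ℕ → R) (N : ℕ) :
    ((List.range N).reverse.map f).prod = ∏ i ∈ Finset.range N, f i := by
  induction N with
  | zero => simp
  | succ N ih =>
    rw [List.range_succ, List.reverse_append, Finset.prod_range_succ, ← ih, mul_comm]
    simp

/-- This is the product formula in `N` variables. The last step leads from κ down to ν and up to μ,
with the same letter both times. The sum over κ supplies the new Littlewood factors, and the sum
over ν is the branching rule. -/
theorem hasSum_isOscillating (N : ℕ) (μ : YoungDiagram) :
    HasSum (fun p : {p // IsOscillating N μ p} => monomial (oscWeight N p.1) (1 : ℤ))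
      (littlewoodProd N * schurList (List.range N).reverse μ) := by
  classical
  induction N generalizing μ with
  | zero =>
    simp only [List.range_zero, List.reverse_nil, schurList]
    split_ifs with h
    · subst h
      have : Unique {p // IsOscillating 0 ⊥ p} :=
        { default := ⟨(fun _ => ⊥, fun _ => ⊥), ⟨rfl, fun _ => IsHorizontalStrip.refl _,
            fun _ => IsHorizontalStrip.refl _, fun _ _ => rfl, fun _ _ => rfl⟩⟩
          uniq := fun p => Subtype.ext (Prod.ext
            (funext fun i => p.2.full_eq i (Nat.zero_le i))
            (funext fun i => p.2.part_eq i (Nat.zero_le i))) }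
      have h1 : monomial (oscWeight 0 (default : {p // IsOscillating 0 ⊥ p}).1) (1 : ℤ) =
          littlewoodProd 0 * 1 := by
        simp [oscWeight, littlewoodProd]
      rw [← h1]
      exact hasSum_unique _
    · have : IsEmpty {p // IsOscillating 0 μ p} :=
        ⟨fun p => h ((p.2.full_eq 0 le_rfl).symm.trans p.2.full_zero)⟩
      rw [mul_zero]
      exact hasSum_empty
  | succ N ih =>
    have h := (summable_isOscillating (N + 1) μ).hasSum
    rw [← (oscEquiv N μ).hasSum_iff] at h
    set F : YoungDiagram × YoungDiagram → MvPowerSeries ℕ ℤ := fun q =>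
      stripWeight N q.1 μ * stripWeight N q.1 q.2 *
        (littlewoodProd N * schurList (List.range N).reverse q.2) with hF
    have h1 := h.sigma (g := fun q => F q.1) fun q => by
        refine ((ih q.1.2).mul_left
          (stripWeight N q.1.1 μ * stripWeight N q.1.1 q.1.2)).congr_fun fun p => ?_
        rw [stripWeight_of_strip N q.2.1, stripWeight_of_strip N q.2.2, X_pow_eq, X_pow_eq,
          monomial_mul_monomial, monomial_mul_monomial, one_mul, one_mul,
          ← oscWeight_extendOsc p.2 q.2.1 q.2.2]
        rfl
    have h2 := (hasSum_subtype_iff_of_support_subset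
      (s := {q : YoungDiagram × YoungDiagram |
        IsHorizontalStrip q.1 μ ∧ IsHorizontalStrip q.1 q.2}) (f := F) (by
        intro q hq
        by_contra hn
        apply hq
        rcases not_and_or.1 hn with h | h <;> simp [hF, stripWeight_of_not_strip _ h])).1 h1
    -- For fixed ν, the sum over κ multiplies `littlewoodProd N` by the factors pairing each i < N
    -- with N.
    have h3 := h2.prod_fiberwise (g := fun ν => stripWeight N ν μ *
        (littlewoodProd (N + 1) * schurList (List.range N).reverse ν)) fun ν => by
      have := ((hasSum_stripWeight_mul_schurList N (List.range N).reverse ν).mul_left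
        (littlewoodProd N)).mul_left (stripWeight N ν μ)
      rw [prod_map_reverse_range, ← mul_assoc (littlewoodProd N),
        show littlewoodProd N * _ = littlewoodProd (N + 1) from
          (Finset.prod_range_succ _ _).symm] at this
      refine this.congr_fun fun κ => ?_
      simp only [hF]
      ring
    have h4 : HasSum (fun ν => stripWeight N ν μ *
        (littlewoodProd (N + 1) * schurList (List.range N).reverse ν))
        (littlewoodProd (N + 1) * schurList (List.range (N + 1)).reverse μ) := by
      rw [List.range_succ, List.reverse_append]
      simp only [List.reverse_singleton, List.singleton_append, schurList, Finset.mul_sum]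
      simp only [mul_left_comm (littlewoodProd (N + 1))]
      exact hasSum_sum_of_ne_finset_zero fun ν hν => by
        rw [mem_below] at hν
        simp [stripWeight_of_not_le N hν]
    rw [(oscEquiv N μ).hasSum_iff] at h
    rwa [h3.unique h4] at h

/-! ### Truncation and passage to infinitely many variables -/

open Filter Topology

section Truncation

/-- Equality of the coefficients of all monomials in the first `N` variables. -/
def EqOnFirst (N : ℕ) (f g : MvPowerSeries ℕ ℤ) : Prop :=
  ∀ e : ℕ →₀ ℕ, e.support ⊆ Finset.range N → coeff e f = coeff e g

/-- Divisors of a monomial in the first `N` variables involve only these variables. -/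
theorem EqOnFirst.mul {N : ℕ} {f f' g g' : MvPowerSeries ℕ ℤ} (hf : EqOnFirst N f f')
    (hg : EqOnFirst N g g') : EqOnFirst N (f * g) (f' * g') := by
  classical
  intro e he
  rw [coeff_mul, coeff_mul]
  refine Finset.sum_congr rfl fun p hp => ?_
  have hp := Finset.HasAntidiagonal.mem_antidiagonal.1 hp
  have h1 : p.1 ≤ e := hp ▸ le_self_add
  have h2 : p.2 ≤ e := hp ▸ le_add_self
  rw [hf p.1 ((Finsupp.support_mono h1).trans he), hg p.2 ((Finsupp.support_mono h2).trans he)]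

theorem eqOnFirst_prod_one {ι : Type*} {N : ℕ} {s : Finset ι} {f : ι → MvPowerSeries ℕ ℤ}
    (h : ∀ i ∈ s, EqOnFirst N (f i) 1) : EqOnFirst N (∏ i ∈ s, f i) 1 := by
  refine Finset.prod_induction f (fun g => EqOnFirst N g 1) (fun a b ha hb => ?_)
    (fun _ _ => rfl) h
  simpa using ha.mul hb

/-- The factor is 1 plus a multiple of `X j`, and j ≥ N. -/
theorem eqOnFirst_littlewoodFactor {N i j : ℕ} (h : N ≤ j) :
    EqOnFirst N (littlewoodFactor i j) 1 := by
  intro e he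
  have h1 : littlewoodFactor i j = 1 + X j * (X i * littlewoodFactor i j) := by
    linear_combination one_sub_mul_littlewoodFactor i j
  have h2 : coeff e (X j * (X i * littlewoodFactor i j)) = 0 := by
    refine X_dvd_iff.1 (Dvd.intro _ rfl) e ?_
    by_contra hne
    have := Finset.mem_range.1 (he (Finsupp.mem_support_iff.2 hne))
    omega
  rw [h1, map_add, h2, add_zero]

/-- The pairs `i < j < N`. -/
def pairsBelow (N : ℕ) : Finset {p : ℕ × ℕ // p.1 < p.2} :=
  (Finset.range N ×ˢ Finset.range N).subtype fun p => p.1 < p.2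

theorem mem_pairsBelow {N : ℕ} {p : {p : ℕ × ℕ // p.1 < p.2}} :
    p ∈ pairsBelow N ↔ p.1.2 < N := by
  have := p.2
  simp only [pairsBelow, Finset.mem_subtype, Finset.mem_product, Finset.mem_range]
  omega

theorem littlewoodProd_eq_prod (N : ℕ) :
    littlewoodProd N = ∏ p ∈ pairsBelow N, littlewoodFactor p.1.1 p.1.2 := by
  have h := Finset.prod_subtype_eq_prod_filter (s := Finset.range N ×ˢ Finset.range N)
    (p := fun p : ℕ × ℕ => p.1 < p.2) fun p => littlewoodFactor p.1 p.2
  refine Eq.trans ?_ h.symm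
  rw [Finset.prod_filter, Finset.prod_product_right, littlewoodProd]
  refine Finset.prod_congr rfl fun j hj => ?_
  rw [← Finset.prod_filter]
  refine Finset.prod_congr ?_ fun _ _ => rfl
  ext i
  simp only [Finset.mem_filter, Finset.mem_range] at *
  omega

theorem multipliable_littlewoodFactor :
    Multipliable fun p : {p : ℕ × ℕ // p.1 < p.2} => littlewoodFactor p.1.1 p.1.2 := by
  classical
  have hb : ∀ e : ℕ →₀ ℕ, ∃ N, e.support ⊆ Finset.range N := fun e =>
    e.support.exists_nat_subset_range
  choose B hB using hb
  -- The coefficient at `e` is stationary once the finite product contains all pairs below `B e`,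
  -- where `B e` bounds the variables in `e`.
  refine ⟨fun e => coeff e (littlewoodProd (B e)), ?_⟩
  refine (WithPiTopology.tendsto_iff_coeff_tendsto _ _ _).2 fun e => ?_
  refine tendsto_const_nhds.congr' ?_
  filter_upwards [eventually_ge_atTop (pairsBelow (B e))] with s hs
  rw [← Finset.prod_sdiff hs, ← littlewoodProd_eq_prod]
  have h1 : EqOnFirst (B e) (∏ p ∈ s \ pairsBelow (B e), littlewoodFactor p.1.1 p.1.2) 1 :=
    eqOnFirst_prod_one fun p hp => eqOnFirst_littlewoodFactor (by
      rw [Finset.mem_sdiff, mem_pairsBelow] at hp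
      omega)
  have h2 := h1.mul (fun _ _ => rfl : EqOnFirst (B e) (littlewoodProd (B e)) _) e (hB e)
  rw [one_mul] at h2
  exact h2.symm

theorem tendsto_littlewoodProd :
    Tendsto littlewoodProd atTop
      (𝓝 (∏' p : {p : ℕ × ℕ // p.1 < p.2}, littlewoodFactor p.1.1 p.1.2)) := by
  have h : Tendsto pairsBelow atTop atTop := by
    refine tendsto_atTop_finset_of_monotone (fun M N h p hp => ?_) fun p => ⟨p.1.2 + 1, ?_⟩
    · rw [mem_pairsBelow] at *
      omega
    · rw [mem_pairsBelow]
      omega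
  have h' : Tendsto (fun s : Finset {p : ℕ × ℕ // p.1 < p.2} =>
      ∏ p ∈ s, littlewoodFactor p.1.1 p.1.2) atTop (𝓝 _) := multipliable_littlewoodFactor.hasProd
  exact (h'.comp h).congr fun N => (littlewoodProd_eq_prod N).symm

/-- Terms involving a later variable do not contribute to these coefficients, so truncating the
series amounts to restricting the index set. -/
theorem coeff_tsum_monomial_eq {ι : Type*} {w : ι → ℕ →₀ ℕ} {g : MvPowerSeries ℕ ℤ} {N : ℕ}
    (hs : Summable fun i => monomial (w i) (1 : ℤ))
    (hg : HasSum (fun i : {i | (w i).support ⊆ Finset.range N} => monomial (w i) (1 : ℤ)) g) :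
    EqOnFirst N (∑' i, monomial (w i) (1 : ℤ)) g := by
  classical
  intro e he
  have h1 := WithPiTopology.hasSum_iff_hasSum_coeff.1 hs.hasSum e
  have h2 := WithPiTopology.hasSum_iff_hasSum_coeff.1 hg e
  refine h1.unique ((hasSum_subtype_iff_of_support_subset ?_).1 h2)
  intro i hi
  by_contra hn
  refine hi ?_
  simp only [coeff_monomial]
  rw [if_neg]
  rintro rfl
  exact hn he

theorem tendsto_of_eqOnFirst {f : MvPowerSeries ℕ ℤ} {g : ℕ → MvPowerSeries ℕ ℤ}
    (h : ∀ N, EqOnFirst N f (g N)) : Tendsto g atTop (𝓝 f) := by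
  refine (WithPiTopology.tendsto_iff_coeff_tendsto _ _ _).2 fun e => ?_
  refine tendsto_const_nhds.congr' ?_
  obtain ⟨M, hM⟩ := e.support.exists_nat_subset_range
  filter_upwards [eventually_ge_atTop M] with N hN
  exact h N e (hM.trans (Finset.range_subset_range.2 hN))

end Truncation

theorem summable_monomial_of_finite {ι : Type*} {w : ι → ℕ →₀ ℕ}
    (h : ∀ N e, {i | (w i).support ⊆ Finset.range N ∧ w i = e}.Finite) :
    Summable fun i => monomial (w i) (1 : ℤ) := by
  classical
  refine summable_of_finite_coeff_ne_zero fun e => ?_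
  obtain ⟨N, hN⟩ := e.support.exists_nat_subset_range
  refine (h N e).subset fun i hi => ?_
  simp only [Set.mem_ofPred_eq, coeff_monomial, ne_eq, ite_eq_right_iff, one_ne_zero, imp_false,
    not_not] at hi
  subst hi
  exact ⟨hN, rfl⟩

/-! ### Truncation of the Schur function -/

section Schur

variable {μ : YoungDiagram}

theorem SemistandardYoungTableau.weightMonomial_eq (T : SemistandardYoungTableau μ) :
    T.weightMonomial = monomial (fillingWeight μ T) (1 : ℤ) := by
  rw [weightMonomial, fillingWeight]
  induction μ.cells using Finset.cons_induction with
  | empty => simp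
  | cons b s hb ih =>
    rw [Finset.prod_cons, Finset.sum_cons, ih, X, monomial_mul_monomial, one_mul]

theorem support_fillingWeight_subset_iff {f : ℕ → ℕ → ℕ} {N : ℕ} :
    (fillingWeight μ f).support ⊆ Finset.range N ↔ ∀ b ∈ μ, f b.1 b.2 < N := by
  constructor
  · intro h b hb
    refine Finset.mem_range.1 (h (Finsupp.mem_support_iff.2 ?_))
    rw [fillingWeight, Finsupp.finsetSum_apply]
    refine (Finset.sum_pos' (fun _ _ => Nat.zero_le _) ⟨b, hb, ?_⟩).ne'
    simp
  · intro h a ha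
    rw [Finsupp.mem_support_iff, fillingWeight, Finsupp.finsetSum_apply] at ha
    obtain ⟨b, hb, hne⟩ := Finset.exists_ne_zero_of_sum_ne_zero ha
    rw [Finsupp.single_apply_ne_zero] at hne
    rw [hne.1, Finset.mem_range]
    exact h b hb

/-- Tableaux with entries smaller than `N` as functions. -/
def tableauSubtypeEquiv (N : ℕ) (μ : YoungDiagram) :
    {T : SemistandardYoungTableau μ | (fillingWeight μ T).support ⊆ Finset.range N} ≃
      {f // IsTableau N μ f} where
  toFun T := ⟨T.1, ⟨T.1.row_weak, T.1.col_strict, T.1.zeros,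
    fun h => support_fillingWeight_subset_iff.1 T.2 _ h⟩⟩
  invFun f := ⟨⟨f.1, f.2.row_weak, f.2.col_strict, f.2.zeros⟩,
    support_fillingWeight_subset_iff.2 fun _ hb => f.2.lt hb⟩
  left_inv _ := rfl
  right_inv _ := rfl

theorem summable_weightMonomial_tableau (μ : YoungDiagram) :
    Summable fun T : SemistandardYoungTableau μ => T.weightMonomial := by
  simp only [SemistandardYoungTableau.weightMonomial_eq]
  refine summable_monomial_of_finite fun N e => ?_
  refine Set.Finite.of_finite_image (f := fun T : SemistandardYoungTableau μ => (T : ℕ → ℕ → ℕ))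
    ((finite_setOf_isTableau N μ).subset ?_) DFunLike.coe_injective.injOn
  rintro _ ⟨T, hT, rfl⟩
  exact (tableauSubtypeEquiv N μ ⟨T, hT.1⟩).2

theorem eqOnFirst_schurFunction (N : ℕ) (μ : YoungDiagram) :
    EqOnFirst N (schurFunction μ) (schurList (List.range N).reverse μ) := by
  have hs := summable_weightMonomial_tableau μ
  simp only [schurFunction, SemistandardYoungTableau.weightMonomial_eq] at hs ⊢
  exact coeff_tsum_monomial_eq hs ((tableauSubtypeEquiv N μ).hasSum_iff.2 (hasSum_isTableau N μ))

end Schur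

/-! ### Truncation of the SSOT function -/

namespace SSOT

variable {μ : YoungDiagram}

theorem weight_apply {n : ℕ} (S : SSOT n μ) (i : ℕ) : S.weight i = oscStep (S.full, S.part) i :=
  rfl

/-- A step of size zero leaves the diagram unchanged, so the sequence is constant from `N` on, and
the constant is the eventual shape μ. -/
theorem eq_of_stepSize_eq_zero {n N : ℕ} (S : SSOT n μ) (h : ∀ i, N ≤ i → S.stepSize i = 0) :
    ∀ i, N ≤ i → S.full i = μ ∧ S.part i = μ := by
  have key : ∀ i, N ≤ i → S.part i = S.full i ∧ S.part i = S.full (i + 1) := by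
    intro i hi
    have h1 := h i hi
    rw [stepSize, card_sdiff_cells (S.strip_removed i).le, card_sdiff_cells (S.strip_added i).le]
      at h1
    have h2 := card_le_card (S.strip_removed i).le
    have h3 := card_le_card (S.strip_added i).le
    exact ⟨eq_of_le_of_card_eq (S.strip_removed i).le (by omega),
      eq_of_le_of_card_eq (S.strip_added i).le (by omega)⟩
  obtain ⟨k, hk, -⟩ := S.exists_steps
  have hconst : ∀ i, N ≤ i → ∀ m, S.full (i + m) = S.full i := by
    intro i hi m
    induction m with
    | zero => rfl
    | succ m ih =>
      obtain ⟨h1, h2⟩ := key (i + m) (by omega)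
      rw [← ih, ← h1, ← add_assoc, h2]
  intro i hi
  have h1 : S.full i = μ := by
    rw [← hconst i hi k]
    exact (hk (i + k) (by omega)).1
  exact ⟨h1, (key i hi).1.trans h1⟩

theorem degree_weight {n : ℕ} (S : SSOT n μ) : S.weight.degree = n := by
  obtain ⟨k, hk, hn⟩ := S.exists_steps
  refine Eq.trans ?_ hn.symm
  rw [Finsupp.degree_apply]
  refine Finset.sum_subset (fun i hi => ?_) fun i _ hi => Finsupp.notMem_support_iff.1 hi
  · rw [Finset.mem_range]
    by_contra! hki
    refine Finsupp.mem_support_iff.1 hi ?_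
    rw [weight_apply]
    simp [oscStep, (hk i hki).1, (hk i hki).2, (hk (i + 1) (by omega)).1]

/-- The length is the degree of the weight, hence determined by the diagrams. -/
theorem sigma_ext {S S' : Σ n, SSOT n μ} (h1 : S.2.full = S'.2.full)
    (h2 : S.2.part = S'.2.part) : S = S' := by
  obtain ⟨n, S⟩ := S
  obtain ⟨n', S'⟩ := S'
  simp only at h1 h2
  have hw : S.weight = S'.weight := by
    ext i
    rw [weight_apply, weight_apply, h1, h2]
  obtain rfl : n = n' := by rw [← S.degree_weight, ← S'.degree_weight, hw]
  rw [SSOT.ext h1 h2]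

theorem isOscillating {n N : ℕ} (S : SSOT n μ) (h : S.weight.support ⊆ Finset.range N) :
    IsOscillating N μ (S.full, S.part) := by
  have h1 := S.eq_of_stepSize_eq_zero (N := N) fun i hi => by
    by_contra hne
    have := Finset.mem_range.1 (h (Finsupp.mem_support_iff.2 hne))
    omega
  exact ⟨S.full_zero, S.strip_removed, S.strip_added, fun i hi => (h1 i hi).1,
    fun i hi => (h1 i hi).2⟩

end SSOT

theorem oscWeight_apply {N i : ℕ} (p : (ℕ → YoungDiagram) × (ℕ → YoungDiagram)) :
    oscWeight N p i = if i < N then oscStep p i else 0 := by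
  simp [oscWeight, Finsupp.finsetSum_apply, Finsupp.single_apply]

namespace IsOscillating

variable {N : ℕ} {μ : YoungDiagram} {p : (ℕ → YoungDiagram) × (ℕ → YoungDiagram)}

/-- The oscillating tableau given by an oscillating sequence. -/
def toSSOT (hp : IsOscillating N μ p) : SSOT (∑ i ∈ Finset.range N, oscStep p i) μ where
  full := p.1
  part := p.2
  full_zero := hp.full_zero
  strip_removed := hp.strip_removed
  strip_added := hp.strip_added
  exists_steps := ⟨N, fun i hi => ⟨hp.full_eq i hi, hp.part_eq i hi⟩, rfl⟩

theorem weight_toSSOT (hp : IsOscillating N μ p) : hp.toSSOT.weight = oscWeight N p := by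
  ext i
  rw [oscWeight_apply]
  split_ifs with h
  · rfl
  · rw [SSOT.weight_apply]
    simp [toSSOT, oscStep, hp.full_eq i (by omega), hp.full_eq (i + 1) (by omega),
      hp.part_eq i (by omega)]

theorem support_oscWeight_subset : (oscWeight N p).support ⊆ Finset.range N := by
  intro i hi
  rw [Finsupp.mem_support_iff, oscWeight_apply] at hi
  rw [Finset.mem_range]
  by_contra h
  simp [h] at hi

end IsOscillating

/-- Oscillating tableaux that use the first `N` letters as oscillating sequences. -/
def ssotSubtypeEquiv (N : ℕ) (μ : YoungDiagram) :
    {S : Σ n, SSOT n μ | S.2.weight.support ⊆ Finset.range N} ≃ {p // IsOscillating N μ p} where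
  toFun S := ⟨(S.1.2.full, S.1.2.part), S.1.2.isOscillating S.2⟩
  invFun p := ⟨⟨_, p.2.toSSOT⟩, by
    rw [Set.mem_ofPred_eq, p.2.weight_toSSOT]
    exact IsOscillating.support_oscWeight_subset⟩
  left_inv _ := Subtype.ext (SSOT.sigma_ext rfl rfl)
  right_inv _ := rfl

theorem oscWeight_ssotSubtypeEquiv {N : ℕ} {μ : YoungDiagram}
    (S : {S : Σ n, SSOT n μ | S.2.weight.support ⊆ Finset.range N}) :
    oscWeight N (ssotSubtypeEquiv N μ S).1 = S.1.2.weight := by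
  obtain ⟨p, rfl⟩ := (ssotSubtypeEquiv N μ).symm.surjective S
  rw [Equiv.apply_symm_apply]
  exact p.2.weight_toSSOT.symm

theorem summable_weightMonomial_ssot (μ : YoungDiagram) :
    Summable fun S : Σ n, SSOT n μ => S.2.weightMonomial := by
  refine summable_monomial_of_finite fun N e => ?_
  refine Set.Finite.of_finite_image (f := fun S : Σ n, SSOT n μ => (S.2.full, S.2.part))
    ((finite_setOf_isOscillating N μ e).subset ?_) fun S _ S' _ h =>
      SSOT.sigma_ext (congrArg Prod.fst h) (congrArg Prod.snd h)
  rintro _ ⟨S, hS, rfl⟩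
  exact ⟨S.2.isOscillating hS.1, (oscWeight_ssotSubtypeEquiv ⟨S, hS.1⟩).trans hS.2⟩

theorem ssotFunction_eq_tsum_sigma (μ : YoungDiagram) :
    ssotFunction μ = ∑' S : Σ n, SSOT n μ, S.2.weightMonomial :=
  ((summable_weightMonomial_ssot μ).tsum_sigma'
    fun n => (summable_weightMonomial_ssot μ).sigma_factor n).symm

theorem eqOnFirst_ssotFunction (N : ℕ) (μ : YoungDiagram) :
    EqOnFirst N (ssotFunction μ) (littlewoodProd N * schurList (List.range N).reverse μ) := by
  rw [ssotFunction_eq_tsum_sigma]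
  refine coeff_tsum_monomial_eq (summable_weightMonomial_ssot μ) ?_
  refine ((ssotSubtypeEquiv N μ).hasSum_iff.2 (hasSum_isOscillating N μ)).congr_fun fun S => ?_
  rw [Function.comp_apply, oscWeight_ssotSubtypeEquiv]

/-- Both sides are limits of the products `littlewoodProd N * schurList (List.range N).reverse μ`.
-/
theorem ssotFunction_eq_tprod_mul_schurFunction (μ : YoungDiagram) :
    ssotFunction μ =
      (∏' p : {p : ℕ × ℕ // p.1 < p.2}, littlewoodFactor p.1.1 p.1.2) * schurFunction μ :=
  tendsto_nhds_unique (tendsto_of_eqOnFirst fun N => eqOnFirst_ssotFunction N μ)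
    (tendsto_littlewoodProd.mul (tendsto_of_eqOnFirst fun N => eqOnFirst_schurFunction N μ))

/-! ### Symmetry under permutations of the variables -/

section Symmetry

theorem coeff_renameEquiv (σ : Equiv.Perm ℕ) (f : MvPowerSeries ℕ ℤ) (e : ℕ →₀ ℕ) :
    coeff e (renameEquiv ℤ σ f) = coeff (e.mapDomain σ.symm) f := by
  have h := coeff_embDomain_rename σ.toEmbedding f (e.mapDomain σ.symm)
  rw [Finsupp.embDomain_eq_mapDomain, ← Finsupp.mapDomain_comp] at h
  simpa using h

/-- Each coefficient of the image is a coefficient of the argument. -/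
theorem continuous_renameEquiv (σ : Equiv.Perm ℕ) : Continuous (renameEquiv ℤ σ) := by
  refine continuous_iff_continuousAt.2 fun f => ?_
  refine (WithPiTopology.tendsto_iff_coeff_tendsto _ _ _).2 fun e => ?_
  simp only [coeff_renameEquiv]
  exact (WithPiTopology.continuous_coeff ℤ _).tendsto f

theorem renameEquiv_X (σ : Equiv.Perm ℕ) (i : ℕ) :
    renameEquiv ℤ σ (X i : MvPowerSeries ℕ ℤ) = X (σ i) := rename_X (σ : ℕ → ℕ) i

theorem renameEquiv_littlewoodFactor (σ : Equiv.Perm ℕ) (i j : ℕ) :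
    renameEquiv ℤ σ (littlewoodFactor i j) = littlewoodFactor (σ i) (σ j) := by
  have h := congrArg (renameEquiv ℤ σ) (one_sub_mul_littlewoodFactor i j)
  rw [map_mul, map_sub, map_mul, map_one, renameEquiv_X, renameEquiv_X] at h
  calc _ = littlewoodFactor (σ i) (σ j) * (1 - X (σ i) * X (σ j)) *
        renameEquiv ℤ σ (littlewoodFactor i j) := by
        rw [mul_comm (littlewoodFactor _ _), one_sub_mul_littlewoodFactor, one_mul]
    _ = _ := by rw [mul_assoc, h, mul_one]

/-- The action of a permutation on pairs of indices. -/
def permPair (σ : Equiv.Perm ℕ) (p : {p : ℕ × ℕ // p.1 < p.2}) : {p : ℕ × ℕ // p.1 < p.2} :=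
  if h : σ p.1.1 < σ p.1.2 then ⟨(σ p.1.1, σ p.1.2), h⟩
  else ⟨(σ p.1.2, σ p.1.1), lt_of_le_of_ne (not_lt.1 h) fun he => p.2.ne' (σ.injective he)⟩

theorem permPair_symm_permPair (σ : Equiv.Perm ℕ) (p : {p : ℕ × ℕ // p.1 < p.2}) :
    permPair σ.symm (permPair σ p) = p := by
  have hp := p.2
  by_cases h : σ p.1.1 < σ p.1.2
  · simp [permPair, h, hp]
  · simp [permPair, h, hp.not_gt]

theorem littlewoodFactor_permPair (σ : Equiv.Perm ℕ) (p : {p : ℕ × ℕ // p.1 < p.2}) :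
    littlewoodFactor (permPair σ p).1.1 (permPair σ p).1.2 =
      renameEquiv ℤ σ (littlewoodFactor p.1.1 p.1.2) := by
  rw [renameEquiv_littlewoodFactor]
  by_cases h : σ p.1.1 < σ p.1.2
  · simp [permPair, h]
  · simp [permPair, h, littlewoodFactor_comm]

theorem isSymmetricSeries_tprod_littlewoodFactor :
    IsSymmetricSeries (∏' p : {p : ℕ × ℕ // p.1 < p.2}, littlewoodFactor p.1.1 p.1.2) := by
  intro σ
  rw [multipliable_littlewoodFactor.map_tprod (renameEquiv ℤ σ) (continuous_renameEquiv σ)]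
  let E : {p : ℕ × ℕ // p.1 < p.2} ≃ {p : ℕ × ℕ // p.1 < p.2} :=
    ⟨permPair σ, permPair σ.symm, permPair_symm_permPair σ, permPair_symm_permPair σ.symm⟩
  rw [← E.tprod_eq fun p => littlewoodFactor p.1.1 p.1.2]
  exact tprod_congr fun p => (littlewoodFactor_permPair σ p).symm

/-- Without the variable `a` in the monomial, only the empty strip ν = μ contributes. -/
theorem coeff_schurList_cons {e : ℕ →₀ ℕ} {a : ℕ} (ha : e a = 0) (l : List ℕ) (μ : YoungDiagram) :
    coeff e (schurList (a :: l) μ) = coeff e (schurList l μ) := by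
  rw [schurList, map_sum, Finset.sum_eq_single_of_mem μ (mem_below.2 le_rfl)]
  · simp [stripWeight_of_strip a (IsHorizontalStrip.refl μ)]
  · intro ν hν hne
    by_cases h : IsHorizontalStrip ν μ
    · rw [stripWeight_of_strip a h]
      refine X_pow_dvd_iff.1 (Dvd.intro _ rfl) e ?_
      have h1 := card_le_card h.le
      have h2 : ν.card ≠ μ.card := fun hc => hne (eq_of_le_of_card_eq h.le hc)
      omega
    · simp [stripWeight_of_not_strip a h]

theorem coeff_schurList_append {e : ℕ →₀ ℕ} {l : List ℕ} (hl : ∀ a ∈ l, e a = 0) (l' : List ℕ)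
    (μ : YoungDiagram) : coeff e (schurList (l ++ l') μ) = coeff e (schurList l' μ) := by
  induction l with
  | nil => rfl
  | cons a l ih =>
    rw [List.cons_append, coeff_schurList_cons (hl a List.mem_cons_self),
      ih fun b hb => hl b (List.mem_cons_of_mem a hb)]

/-- A permutation does not preserve initial segments of ℕ, so the limit is taken along all finite
sets of variables. By `schurList_perm` the letters outside an initial segment can be put first,
where they drop out of the coefficient. -/
theorem tendsto_schurList_toList (μ : YoungDiagram) :
    Tendsto (fun A : Finset ℕ => schurList A.toList μ) atTop (𝓝 (schurFunction μ)) := by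
  refine (WithPiTopology.tendsto_iff_coeff_tendsto _ _ _).2 fun e => ?_
  refine tendsto_const_nhds.congr' ?_
  obtain ⟨N, hN⟩ := e.support.exists_nat_subset_range
  filter_upwards [eventually_ge_atTop (Finset.range N)] with A hA
  have hp : A.toList.Perm ((A \ Finset.range N).toList ++ (List.range N).reverse) := by
    refine (List.perm_ext_iff_of_nodup A.nodup_toList ?_).2 fun a => ?_
    · refine (Finset.nodup_toList _).append (List.nodup_reverse.2 List.nodup_range) ?_
      intro a h1 h2
      simp only [Finset.mem_toList, Finset.mem_sdiff, Finset.mem_range, List.mem_reverse,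
        List.mem_range] at h1 h2
      exact h1.2 h2
    · have := @hA a
      simp only [Finset.mem_toList, List.mem_append, Finset.mem_sdiff, Finset.mem_range,
        List.mem_reverse, List.mem_range] at this ⊢
      tauto
  rw [schurList_perm hp, coeff_schurList_append, eqOnFirst_schurFunction N μ e hN]
  intro a ha
  rw [Finset.mem_toList, Finset.mem_sdiff] at ha
  exact Finsupp.notMem_support_iff.1 fun h => ha.2 (hN h)

theorem renameEquiv_schurList (σ : Equiv.Perm ℕ) (l : List ℕ) (μ : YoungDiagram) :
    renameEquiv ℤ σ (schurList l μ) = schurList (l.map σ) μ := by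
  induction l generalizing μ with
  | nil =>
    simp only [schurList, List.map_nil]
    split_ifs <;> simp
  | cons a l ih =>
    simp only [schurList, List.map_cons, map_sum, map_mul, ih]
    refine Finset.sum_congr rfl fun ν _ => ?_
    by_cases h : IsHorizontalStrip ν μ
    · rw [stripWeight_of_strip _ h, stripWeight_of_strip _ h, map_pow, renameEquiv_X]
    · simp [stripWeight_of_not_strip _ h]

theorem isSymmetricSeries_schurFunction (μ : YoungDiagram) :
    IsSymmetricSeries (schurFunction μ) := by
  intro σ
  have h1 := ((continuous_renameEquiv σ).tendsto _).comp (tendsto_schurList_toList μ)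
  -- Taking images under σ is cofinal on finite sets, so the renamed polynomials have the same
  -- limit.
  have hσ : Tendsto (fun A : Finset ℕ => A.map σ.toEmbedding) atTop atTop := by
    refine Monotone.tendsto_atTop_atTop (fun _ _ h => Finset.map_subset_map.2 h) fun B =>
      ⟨B.map σ.symm.toEmbedding, fun b hb => ?_⟩
    simpa using hb
  refine tendsto_nhds_unique h1 (((tendsto_schurList_toList μ).comp hσ).congr fun A => ?_)
  rw [Function.comp_apply, Function.comp_apply, renameEquiv_schurList]
  refine congrFun (schurList_perm ?_) μ
  refine (List.perm_ext_iff_of_nodup (Finset.nodup_toList _)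
    (A.nodup_toList.map σ.injective)).2 fun a => ?_
  simp [-Finset.mem_map_equiv]

end Symmetry

theorem theorem3 (μ : YoungDiagram) :
    -- all the infinite sums and the infinite product are well defined
    ((∀ n : ℕ, Summable fun S : SSOT n μ => S.weightMonomial) ∧
      (Summable fun n : ℕ => ssotFunctionOfDegree μ n) ∧
      (Summable fun T : SemistandardYoungTableau μ => T.weightMonomial) ∧
      (Multipliable fun p : {p : ℕ × ℕ // p.1 < p.2} => littlewoodFactor p.1.1 p.1.2)) ∧
    -- the product formula
    ssotFunction μ =
      (∏' p : {p : ℕ × ℕ // p.1 < p.2}, littlewoodFactor p.1.1 p.1.2) * schurFunction μ ∧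
    -- the symmetry
    IsSymmetricSeries (ssotFunction μ) := by
  refine ⟨⟨fun n => (summable_weightMonomial_ssot μ).sigma_factor n,
    (summable_weightMonomial_ssot μ).sigma, summable_weightMonomial_tableau μ,
    multipliable_littlewoodFactor⟩, ssotFunction_eq_tprod_mul_schurFunction μ, fun σ => ?_⟩
  rw [ssotFunction_eq_tprod_mul_schurFunction, map_mul,
    isSymmetricSeries_tprod_littlewoodFactor σ, isSymmetricSeries_schurFunction μ σ]
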